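/- Let $m\ge 0$ be an integer, let $S$ be a compact (Hausdorff) smooth $m$-dimensional manifold without boundary, and let $(f_t)_{t\in[0,1]}$ be a family of immersions $f_t:S\to\mathbb R^{m+1}$ such that $(t,x)\mapsto f_t(x)$ is smooth on $[0,1]\times S$. Let $\nu_t(x)$ be a unit vector orthogonal to $df_t(T_xS)$ that depends continuously on $(t,x)\in[0,1]\times S$ (an orientation of the family of hypersurfaces). Write $I_t(X,Y)=\langle df_t(X),df_t(Y)\rangle$ for the induced metric, $dA_t$ for its Riemannian volume measure on $S$, $B_t$ for the shape operator, defined by $df_t(B_tX)=-d\nu_t(X)$, and $H_t=\operatorname{tr}B_t$ for the mean curvature. If the deformation is isometric, that is, $I_t=I_0$ for all $t\in[0,1]$, then $H_t$ is integrable with respect to $dA_t$ for every $t\in[0,1]$, and $$\int_S H_t\,dA_t=\int_S H_0\,dA_0\qquad\text{for all } t\in[0,1].$$ -/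

import Mathlib

open scoped Manifold ContDiff

noncomputable section

namespace HypersurfaceBending

variable {m : ℕ} {S : Type*} [TopologicalSpace S] [ChartedSpace (EuclideanSpace ℝ (Fin m)) S]

/-- The differential at `x` of a map from an `m`-manifold `S` to `ℝ^{m+1}`. -/
def differential (f : S → EuclideanSpace ℝ (Fin (m + 1))) (x : S) :
    TangentSpace (𝓡 m) x →ₗ[ℝ] EuclideanSpace ℝ (Fin (m + 1)) :=
  (mfderiv (𝓡 m) 𝓘(ℝ, EuclideanSpace ℝ (Fin (m + 1))) f x :
    TangentSpace (𝓡 m) x →L[ℝ] EuclideanSpace ℝ (Fin (m + 1))).toLinearMap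

/-- `f : S → ℝ^{m+1}` is a smooth immersed hypersurface. -/
def IsImmersedHypersurface (f : S → EuclideanSpace ℝ (Fin (m + 1))) : Prop :=
  ContMDiff (𝓡 m) 𝓘(ℝ, EuclideanSpace ℝ (Fin (m + 1))) ∞ f ∧
    ∀ x, Function.Injective (differential f x)

/-- `ν` is a unit vector at each point, orthogonal to the hypersurface `f`. -/
def IsUnitNormal (f ν : S → EuclideanSpace ℝ (Fin (m + 1))) : Prop :=
  ∀ x, ‖ν x‖ = 1 ∧ ∀ X : TangentSpace (𝓡 m) x, inner ℝ (differential f x X) (ν x) = 0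

/-- The induced metric (first fundamental form) `I(X, Y) = ⟨df X, df Y⟩`. -/
def inducedMetric (f : S → EuclideanSpace ℝ (Fin (m + 1))) (x : S) :
    TangentSpace (𝓡 m) x →ₗ[ℝ] TangentSpace (𝓡 m) x →ₗ[ℝ] ℝ :=
  (innerₗ (EuclideanSpace ℝ (Fin (m + 1)))).compl₁₂ (differential f x) (differential f x)

/-- The shape operator `B X = - D_X ν` of a hypersurface `f` with unit normal field `ν`. As an
endomorphism of the tangent space of `S` it is characterised by `df (B X) = - dν X`; see
`differential_shapeOperator`. -/
def shapeOperator (f ν : S → EuclideanSpace ℝ (Fin (m + 1))) (x : S) :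
    TangentSpace (𝓡 m) x →ₗ[ℝ] TangentSpace (𝓡 m) x :=
  (differential f x).leftInverse ∘ₗ (-differential ν x)

/-- The mean curvature, the trace of the shape operator. -/
def meanCurvature (f ν : S → EuclideanSpace ℝ (Fin (m + 1))) (x : S) : ℝ :=
  LinearMap.trace ℝ (TangentSpace (𝓡 m) x) (shapeOperator f ν x)

/-- The `i`-th coordinate vector `∂ᵢ` of the chart `e`, at the point with coordinates `y`. -/
def coordVector (e : OpenPartialHomeomorph S (EuclideanSpace ℝ (Fin m)))
    (y : EuclideanSpace ℝ (Fin m)) (i : Fin m) : TangentSpace (𝓡 m) (e.symm y) :=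
  (mfderiv 𝓘(ℝ, EuclideanSpace ℝ (Fin m)) (𝓡 m) e.symm y :
    EuclideanSpace ℝ (Fin m) →L[ℝ] TangentSpace (𝓡 m) (e.symm y)) (EuclideanSpace.single i 1)

/-- The matrix `g_{ij} = g(∂ᵢ, ∂ⱼ)` of a metric `g` in the chart `e`. -/
def gramMatrix
    (g : ∀ x : S, TangentSpace (𝓡 m) x →ₗ[ℝ] TangentSpace (𝓡 m) x →ₗ[ℝ] ℝ)
    (e : OpenPartialHomeomorph S (EuclideanSpace ℝ (Fin m))) (y : EuclideanSpace ℝ (Fin m)) :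
    Matrix (Fin m) (Fin m) ℝ :=
  Matrix.of fun i j => g (e.symm y) (coordVector e y i) (coordVector e y j)

/-- The volume measure of the metric `g` on the domain of the chart `e`: the measure
`√(det g_{ij}) dy` on the image of the chart, carried over to `S`. -/
def chartVolume [MeasurableSpace S]
    (g : ∀ x : S, TangentSpace (𝓡 m) x →ₗ[ℝ] TangentSpace (𝓡 m) x →ₗ[ℝ] ℝ)
    (e : OpenPartialHomeomorph S (EuclideanSpace ℝ (Fin m))) : MeasureTheory.Measure S :=
  (((MeasureTheory.volume : MeasureTheory.Measure (EuclideanSpace ℝ (Fin m))).restrict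
    e.target).withDensity fun y => ENNReal.ofReal √(gramMatrix g e y).det).map e.symm

/-- A smooth partition of unity on `S`, indexed by the points of `S`, whose member with index `p`
is supported in the domain of the chart at `p`. -/
def chartPartition (m : ℕ) (S : Type*) [TopologicalSpace S]
    [ChartedSpace (EuclideanSpace ℝ (Fin m)) S] [IsManifold (𝓡 m) ∞ S] [T2Space S]
    [SigmaCompactSpace S] : SmoothPartitionOfUnity S (𝓡 m) S Set.univ :=
  (SmoothPartitionOfUnity.exists_isSubordinate_chartAt_source (𝓡 m) S).choose

theorem chartPartition_isSubordinate (m : ℕ) (S : Type*) [TopologicalSpace S]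
    [ChartedSpace (EuclideanSpace ℝ (Fin m)) S] [IsManifold (𝓡 m) ∞ S] [T2Space S]
    [SigmaCompactSpace S] :
    (chartPartition m S).IsSubordinate
      fun p => (chartAt (EuclideanSpace ℝ (Fin m)) p).source :=
  (SmoothPartitionOfUnity.exists_isSubordinate_chartAt_source (𝓡 m) S).choose_spec

/-- The Riemannian volume measure `dA` of the metric `g` on `S`, put together from its expressions
`√(det g_{ij}) dy` in charts by a partition of unity. -/
def volumeMeasure [IsManifold (𝓡 m) ∞ S] [T2Space S] [SigmaCompactSpace S] [MeasurableSpace S]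
    (g : ∀ x : S, TangentSpace (𝓡 m) x →ₗ[ℝ] TangentSpace (𝓡 m) x →ₗ[ℝ] ℝ) :
    MeasureTheory.Measure S :=
  MeasureTheory.Measure.sum fun p =>
    (chartVolume g (chartAt (EuclideanSpace ℝ (Fin m)) p)).withDensity
      fun x => ENNReal.ofReal (chartPartition m S p x)

/-- `f t`, `t ∈ [0, 1]`, is a smooth isometric deformation of immersed hypersurfaces: the family
is smooth in `(t, x)`, each `f t` is an immersed hypersurface, and the induced metric does not
depend on `t`. -/
structure IsIsometricDeformation (f : ℝ → S → EuclideanSpace ℝ (Fin (m + 1))) : Prop where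
  smooth : ContMDiffOn (𝓘(ℝ, ℝ).prod (𝓡 m)) 𝓘(ℝ, EuclideanSpace ℝ (Fin (m + 1))) ∞
    (fun p : ℝ × S => f p.1 p.2) (Set.Icc 0 1 ×ˢ Set.univ)
  immersed : ∀ t ∈ Set.Icc (0 : ℝ) 1, IsImmersedHypersurface (f t)
  isometric : ∀ t ∈ Set.Icc (0 : ℝ) 1, inducedMetric (f t) = inducedMetric (f 0)

/-- `ν t` is the unit normal field of an orientation of the hypersurfaces `f t`, `t ∈ [0, 1]`:
a continuous choice of unit normals along the family. -/
structure IsUnitNormalFamily (f ν : ℝ → S → EuclideanSpace ℝ (Fin (m + 1))) : Prop where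
  continuous : ContinuousOn (fun p : ℝ × S => ν p.1 p.2) (Set.Icc 0 1 ×ˢ Set.univ)
  normal : ∀ t ∈ Set.Icc (0 : ℝ) 1, IsUnitNormal (f t) (ν t)

theorem differential_shapeOperator {f ν : S → EuclideanSpace ℝ (Fin (m + 1))}
    (hf : IsImmersedHypersurface f) (hν : IsUnitNormal f ν) (x : S)
    (hd : MDifferentiableAt (𝓡 m) 𝓘(ℝ, EuclideanSpace ℝ (Fin (m + 1))) ν x)
    (X : TangentSpace (𝓡 m) x) :
    differential f x (shapeOperator f ν x X) = -differential ν x X := by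
  have htan : inner ℝ (ν x) (differential ν x X) = 0 := by
    have h1 : HasMFDerivAt (𝓡 m) 𝓘(ℝ, ℝ) (fun z => ‖ν z‖ ^ 2) x
        (((2 : ℕ) • (innerSL ℝ (ν x))).comp
          (mfderiv (𝓡 m) 𝓘(ℝ, EuclideanSpace ℝ (Fin (m + 1))) ν x)) := by
      have h2 := (hasStrictFDerivAt_norm_sq (ν x)).hasFDerivAt
      exact HasMFDerivAt.comp x (hasMFDerivAt_iff_hasFDerivAt.2 h2) hd.hasMFDerivAt
    have h3 : (fun z => ‖ν z‖ ^ 2) = fun _ => (1 : ℝ) := by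
      funext z
      simp [(hν z).1]
    rw [h3] at h1
    have h4 := hasMFDerivAt_unique h1 (hasMFDerivAt_const (1 : ℝ) x)
    have h5 : (2 : ℕ) • inner ℝ (ν x) (differential ν x X) = (0 : ℝ) :=
      congrArg (fun L : TangentSpace (𝓡 m) x →L[ℝ] ℝ => L X) h4
    simpa using h5
  have hker : LinearMap.ker (differential f x) = ⊥ := LinearMap.ker_eq_bot.2 (hf.2 x)
  have hle : LinearMap.range (differential f x) ≤ (ℝ ∙ ν x)ᗮ := by
    rintro _ ⟨Y, rfl⟩
    rw [Submodule.mem_orthogonal_singleton_iff_inner_left]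
    exact (hν x).2 Y
  have hne : ν x ≠ 0 := by
    intro h0
    have := (hν x).1
    simp [h0] at this
  have : Fact (Module.finrank ℝ (EuclideanSpace ℝ (Fin (m + 1))) = m + 1) := ⟨by simp⟩
  have hdim : Module.finrank ℝ (LinearMap.range (differential f x)) =
      Module.finrank ℝ (ℝ ∙ ν x)ᗮ := by
    rw [LinearMap.finrank_range_of_inj (hf.2 x),
      Submodule.finrank_orthogonal_span_singleton (n := m) hne]
    exact finrank_euclideanSpace_fin
  have hmem : -differential ν x X ∈ LinearMap.range (differential f x) := by
    rw [Submodule.eq_of_le_of_finrank_eq hle hdim,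
      Submodule.mem_orthogonal_singleton_iff_inner_right, inner_neg_right, htan, neg_zero]
  obtain ⟨Y, hY⟩ := hmem
  have hB : shapeOperator f ν x X = Y := by
    change (differential f x).leftInverse (-differential ν x X) = Y
    rw [← hY, LinearMap.leftInverse_apply_of_inj hker]
  rw [hB, hY]

end HypersurfaceBending

end

/-!
For hypersurfaces `fₜ` with unit normals `νₜ` inducing one and the same metric `g`, the mean
curvature is `H = -gⁱʲ ⟪∂ᵢf, ∂ⱼν⟫`, and its variation in `t` is a divergence. Indeed
`∂ₜH = -gⁱʲ ⟪∂ₜ∂ᵢf, ∂ⱼν⟫ - gⁱʲ ⟪∂ᵢf, ∂ⱼ∂ₜν⟫`. In the first term the matrix `⟪∂ₜ∂ᵢf, ∂ₖf⟫`, which is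
antisymmetric because the metric does not change, is contracted with the second fundamental form,
which is symmetric, so the term vanishes. The second term is `-div W`, where `W` is the tangent
vector field with `df(W) = ∂ₜν`: this holds since the Laplacian `Δf` is normal to the hypersurface
(`inner_laplacian_eq_zero`) while `∂ₜν` is tangential. The resulting pointwise identity is
`fderiv_meanCurvatureDensity_eq_divergence`.

The divergence theorem on `S` is used in the following form. With a partition of unity `ρₚ`
subordinate to charts, integration by parts in the chart at `p` gives
`d/dt ∫ ρₚ H dA = ∫ dρₚ(W) dA` (`hasDerivAt_chartMeanCurvatureIntegral`). The integrands `dρₚ(W)` no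
longer refer to a chart, and `∑ₚ dρₚ = 0`, so the derivative of the total mean curvature vanishes on
`(0, 1)`. For adding these integrals it matters that the volume measure, glued from charts, restricts
on the domain of each chart to the measure computed in this chart
(`volumeMeasure_restrict_source`), which is the change of variables formula.

The unit normal is only assumed continuous; it is smooth in `(t, x)` by
`IsBendingInCoordinates.contDiffOn_normal`. At the end points `t = 0, 1` only the continuity of the
total mean curvature is needed.
-/

noncomputable section

namespace HypersurfaceBending

/-! ### Determinants, inverses and Gram matrices -/

section Matrices

variable {X : Type*} [NormedAddCommGroup X] [NormedSpace ℝ X] {ι : Type*} [Fintype ι]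
  [DecidableEq ι]

/-- Jacobi's formula: `d (det G) = tr (adj G · dG)`. -/
theorem hasFDerivAt_det {G : X → Matrix ι ι ℝ} {G' : ι → ι → X →L[ℝ] ℝ} {x : X}
    (h : ∀ i j, HasFDerivAt (fun z => G z i j) (G' i j) x) :
    HasFDerivAt (fun z => (G z).det) (∑ i, ∑ j, (G x).adjugate j i • G' i j) x := by
  have h1 : HasFDerivAt (fun z => (G z).det)
      (∑ σ : Equiv.Perm ι, ((Equiv.Perm.sign σ : ℤ) : ℝ) •
        ∑ j, (∏ k ∈ Finset.univ.erase j, G x (σ k) k) • G' (σ j) j) x := by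
    simp only [Matrix.det_apply']
    refine HasFDerivAt.fun_sum fun σ _ => HasFDerivAt.const_mul ?_ _
    exact HasFDerivAt.finsetProd fun j _ => h (σ j) j
  convert h1 using 1
  ext v
  have h2 : ∀ j, ∑ i, (G x).adjugate j i * G' i j v =
      ((G x).updateCol j fun i => G' i j v).det := fun j => by
    rw [← Matrix.cramer_apply, Matrix.cramer_eq_adjugate_mulVec]
    rfl
  have h3 : ∀ j, ((G x).updateCol j fun i => G' i j v).det =
      ∑ σ : Equiv.Perm ι, ((Equiv.Perm.sign σ : ℤ) : ℝ) *
        ((∏ k ∈ Finset.univ.erase j, G x (σ k) k) * G' (σ j) j v) := fun j => by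
    rw [Matrix.det_apply']
    refine Finset.sum_congr rfl fun σ _ => ?_
    rw [← Finset.prod_erase_mul _ _ (Finset.mem_univ j)]
    congr 2
    · exact Finset.prod_congr rfl fun k hk => by
        rw [Matrix.updateCol_ne (Finset.ne_of_mem_erase hk)]
    · simp
  simp only [_root_.sum_apply, _root_.smul_apply, smul_eq_mul]
  rw [Finset.sum_comm]
  simp only [h2, h3, Finset.mul_sum]
  exact Finset.sum_comm

theorem contDiffOn_det {n : WithTop ℕ∞} {G : X → Matrix ι ι ℝ} {s : Set X}
    (h : ∀ i j, ContDiffOn ℝ n (fun z => G z i j) s) :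
    ContDiffOn ℝ n (fun z => (G z).det) s := by
  simp only [Matrix.det_apply']
  exact ContDiffOn.sum fun σ _ => contDiffOn_const.mul (contDiffOn_prod fun i _ => h _ _)

theorem contDiffOn_inv_apply {n : WithTop ℕ∞} {G : X → Matrix ι ι ℝ} {s : Set X}
    (h : ∀ i j, ContDiffOn ℝ n (fun z => G z i j) s) (hd : ∀ z ∈ s, (G z).det ≠ 0) (i j : ι) :
    ContDiffOn ℝ n (fun z => (G z)⁻¹ i j) s := by
  have h1 : ContDiffOn ℝ n (fun z => (G z).adjugate i j) s := by
    simp only [Matrix.adjugate_apply]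
    refine contDiffOn_det fun k l => ?_
    by_cases hk : k = j
    · subst hk
      simpa using contDiffOn_const
    · simpa [Matrix.updateRow_ne hk] using h k l
  simp only [Matrix.inv_def, Matrix.smul_apply, smul_eq_mul, Ring.inverse_eq_inv']
  exact ((contDiffOn_det h).inv hd).mul h1

end Matrices

theorem sum_mul_eq_zero_of_symm_of_antisymm {ι : Type*} [Fintype ι] {s k : ι → ι → ℝ}
    (hs : ∀ i j, s i j = s j i)
    (hk : ∀ i j, k i j + k j i = 0) : ∑ i, ∑ j, s i j * k i j = 0 := by
  have h1 : ∑ i, ∑ j, s i j * k i j = ∑ i, ∑ j, s i j * k j i := by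
    rw [Finset.sum_comm]
    exact Finset.sum_congr rfl fun i _ => Finset.sum_congr rfl fun j _ => by rw [hs]
  have h2 : ∑ i, ∑ j, s i j * k i j + ∑ i, ∑ j, s i j * k j i = 0 := by
    simp only [← Finset.sum_add_distrib, ← mul_add, hk, mul_zero, Finset.sum_const_zero]
  linarith

section Gram

variable {V : Type*} [NormedAddCommGroup V] [InnerProductSpace ℝ V] {ι : Type*} [Fintype ι]
  [DecidableEq ι]

/-- If `n` spans the orthogonal complement of the span of `a`, a vector orthogonal to `n` is
the combination of the `aₖ` with coefficients `∑ₗ gᵏˡ ⟪aₗ, w⟫`. -/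
theorem eq_sum_inv_gram_smul [FiniteDimensional ℝ V]
    (hV : Module.finrank ℝ V = Fintype.card ι + 1) {a : ι → V} {n w : V} {g : Matrix ι ι ℝ}
    (hg : ∀ i j, inner ℝ (a i) (a j) = g i j) (hd : g.det ≠ 0) (hn : n ≠ 0)
    (han : ∀ i, inner ℝ (a i) n = 0) (hw : inner ℝ w n = 0) :
    w = ∑ k, (∑ l, g⁻¹ k l * inner ℝ (a l) w) • a k := by
  have hu : IsUnit g.det := isUnit_iff_ne_zero.2 hd
  have hgi : ∀ v : ι → ℝ, g.mulVec (g⁻¹.mulVec v) = v := fun v => by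
    rw [Matrix.mulVec_mulVec, Matrix.mul_nonsing_inv g hu, Matrix.one_mulVec]
  have hinner : ∀ (b : ι → ℝ) i, inner ℝ (a i) (∑ k, b k • a k) = g.mulVec b i := fun b i => by
    simp [inner_sum, inner_smul_right, hg, Matrix.mulVec, dotProduct, mul_comm]
  have hli : LinearIndependent ℝ a := by
    rw [Fintype.linearIndependent_iff]
    intro b hb i
    have h1 : g.mulVec b = 0 := by
      ext i
      rw [← hinner, hb, inner_zero_right, Pi.zero_apply]
    have h2 : g⁻¹.mulVec (g.mulVec b) = b := by
      rw [Matrix.mulVec_mulVec, Matrix.nonsing_inv_mul g hu, Matrix.one_mulVec]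
    rw [← h2, h1, Matrix.mulVec_zero, Pi.zero_apply]
  have hle : Submodule.span ℝ (Set.range a) ≤ (ℝ ∙ n)ᗮ := by
    rw [Submodule.span_le]
    rintro _ ⟨i, rfl⟩
    exact Submodule.mem_orthogonal_singleton_iff_inner_left.2 (han i)
  have : Fact (Module.finrank ℝ V = Fintype.card ι + 1) := ⟨hV⟩
  have hspan : Submodule.span ℝ (Set.range a) = (ℝ ∙ n)ᗮ :=
    Submodule.eq_of_le_of_finrank_eq hle (by
      rw [finrank_span_eq_card hli,
        Submodule.finrank_orthogonal_span_singleton (n := Fintype.card ι) hn])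
  set r := w - ∑ k, (∑ l, g⁻¹ k l * inner ℝ (a l) w) • a k with hr
  have hra : ∀ i, inner ℝ (a i) r = 0 := fun i => by
    have := hinner (g⁻¹.mulVec fun l => inner ℝ (a l) w) i
    rw [hgi] at this
    rw [hr, inner_sub_right]
    exact sub_eq_zero.2 this.symm
  have hrn : r ∈ Submodule.span ℝ (Set.range a) := by
    rw [hspan, Submodule.mem_orthogonal_singleton_iff_inner_left, hr, inner_sub_left, hw,
      sum_inner]
    simp [inner_smul_left, han]
  have hr0 : inner ℝ r r = 0 := by
    have h1 : Submodule.span ℝ (Set.range a) ≤ (ℝ ∙ r)ᗮ := by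
      rw [Submodule.span_le]
      rintro _ ⟨i, rfl⟩
      exact Submodule.mem_orthogonal_singleton_iff_inner_left.2 (hra i)
    exact Submodule.mem_orthogonal_singleton_iff_inner_left.1 (h1 hrn)
  exact sub_eq_zero.1 (inner_self_eq_zero.1 hr0)

end Gram

/-! ### The variation of the mean curvature is a divergence -/

section Variation

variable {X V : Type*} [NormedAddCommGroup X] [NormedSpace ℝ X] [NormedAddCommGroup V]
  [InnerProductSpace ℝ V] {ι : Type*} [Fintype ι] [DecidableEq ι]

theorem contDiffOn_fderiv_apply {W : Type*} [NormedAddCommGroup W] [NormedSpace ℝ W]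
    {O : Set X} (hO : IsOpen O) {F : X → W} (hF : ContDiffOn ℝ ∞ F O)
    (v : X) : ContDiffOn ℝ ∞ (fun z => fderiv ℝ F z v) O :=
  (hF.fderiv_of_isOpen hO (by simp)).clm_apply contDiffOn_const

theorem differentiableAt_of_contDiffOn {W : Type*} [NormedAddCommGroup W] [NormedSpace ℝ W]
    {O : Set X} (hO : IsOpen O) {F : X → W} {z : X} (hz : z ∈ O) (hF : ContDiffOn ℝ ∞ F O) :
    DifferentiableAt ℝ F z :=
  (hF.contDiffAt (hO.mem_nhds hz)).differentiableAt (by simp)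

theorem fderiv_fderiv_apply_comm {O : Set X} (hO : IsOpen O) {F : X → V}
    (hF : ContDiffOn ℝ ∞ F O) {z : X} (hz : z ∈ O) (v w : X) :
    fderiv ℝ (fun z => fderiv ℝ F z v) z w = fderiv ℝ (fun z => fderiv ℝ F z w) z v := by
  have h1 : DifferentiableAt ℝ (fderiv ℝ F) z :=
    ((hF.fderiv_of_isOpen (m := 1) hO (by norm_cast)).contDiffAt
      (hO.mem_nhds hz)).differentiableAt (by simp)
  have h2 : IsSymmSndFDerivAt ℝ F z :=
    (hF.contDiffAt (hO.mem_nhds hz)).isSymmSndFDerivAt (by simp; norm_cast)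
  rw [fderiv_clm_apply h1 (differentiableAt_const v),
    fderiv_clm_apply h1 (differentiableAt_const w)]
  simpa using h2 w v

theorem fderiv_inner_of_eventuallyEq {A B : X → V} {k : X → ℝ} {z : X}
    (hA : DifferentiableAt ℝ A z) (hB : DifferentiableAt ℝ B z)
    (h : ∀ᶠ y in nhds z, inner ℝ (A y) (B y) = k y) (v : X) :
    inner ℝ (fderiv ℝ A z v) (B z) + inner ℝ (A z) (fderiv ℝ B z v) = fderiv ℝ k z v := by
  rw [← Filter.EventuallyEq.fderiv_eq h, fderiv_inner_apply ℝ hA hB, add_comm]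

/-- The matrix `√(det g) gⁱʲ`, through which the metric `g` enters divergences in coordinates. -/
def inverseMetricDensity (g : Matrix ι ι ℝ) : Matrix ι ι ℝ := √g.det • g⁻¹

theorem contDiffOn_sqrt_det {G : X → Matrix ι ι ℝ} {s : Set X}
    (h : ∀ i j, ContDiffOn ℝ ∞ (fun z => G z i j) s) (hd : ∀ z ∈ s, 0 < (G z).det) :
    ContDiffOn ℝ ∞ (fun z => √(G z).det) s :=
  (contDiffOn_det h).sqrt fun z hz => (hd z hz).ne'

theorem contDiffOn_inverseMetricDensity {G : X → Matrix ι ι ℝ} {s : Set X}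
    (h : ∀ i j, ContDiffOn ℝ ∞ (fun z => G z i j) s) (hd : ∀ z ∈ s, 0 < (G z).det) (i j : ι) :
    ContDiffOn ℝ ∞ (fun z => inverseMetricDensity (G z) i j) s :=
  (contDiffOn_sqrt_det h hd).mul (contDiffOn_inv_apply h (fun z hz => (hd z hz).ne') i j)

theorem inverseMetricDensity_symm {g : Matrix ι ι ℝ} (hg : ∀ i j, g i j = g j i) (i j : ι) :
    inverseMetricDensity g i j = inverseMetricDensity g j i := by
  have h : g.transpose = g := by
    ext i j
    exact hg j i
  simp only [inverseMetricDensity, Matrix.smul_apply]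
  rw [← Matrix.transpose_apply g⁻¹ j i, Matrix.transpose_nonsing_inv, h]

theorem sum_inverseMetricDensity_mul {g : Matrix ι ι ℝ} (hd : g.det ≠ 0) (j k : ι) :
    ∑ i, inverseMetricDensity g j i * g i k = if j = k then √g.det else 0 := by
  have h : (inverseMetricDensity g * g) j k = (√g.det • (1 : Matrix ι ι ℝ)) j k := by
    rw [inverseMetricDensity, Matrix.smul_mul, Matrix.nonsing_inv_mul g (isUnit_iff_ne_zero.2 hd)]
  rw [Matrix.mul_apply] at h
  rw [h]
  simp [Matrix.one_apply]

/-- `d √(det g) = ½ √(det g) gⁱʲ dgᵢⱼ`. -/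
theorem fderiv_sqrt_det {G : X → Matrix ι ι ℝ} {z : X}
    (h : ∀ i j, DifferentiableAt ℝ (fun z => G z i j) z) (hd : 0 < (G z).det) (v : X) :
    fderiv ℝ (fun z => √(G z).det) z v =
      (∑ i, ∑ j, inverseMetricDensity (G z) j i * fderiv ℝ (fun z => G z i j) z v) / 2 := by
  have h1 := (hasFDerivAt_det fun i j => (h i j).hasFDerivAt).sqrt hd.ne'
  rw [h1.fderiv]
  have hs : √(G z).det * √(G z).det = (G z).det := Real.mul_self_sqrt hd.le
  have hs0 : √(G z).det ≠ 0 := (Real.sqrt_pos.2 hd).ne'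
  have h2 : ∀ i j, inverseMetricDensity (G z) j i = (√(G z).det)⁻¹ * (G z).adjugate j i := by
    intro i j
    simp only [inverseMetricDensity, Matrix.inv_def, Matrix.smul_apply, smul_eq_mul,
      Ring.inverse_eq_inv']
    nth_rewrite 2 [← hs]
    field_simp
  simp only [h2, _root_.smul_apply, _root_.sum_apply, smul_eq_mul, mul_assoc, ← Finset.mul_sum]
  field_simp

section Divergence

variable {O : Set X} (hO : IsOpen O) {u : X → V} (hu : ContDiffOn ℝ ∞ u O)
  {g : X → Matrix ι ι ℝ} {e : ι → X}
  (hg : ∀ z ∈ O, ∀ i j, inner ℝ (fderiv ℝ u z (e i)) (fderiv ℝ u z (e j)) = g z i j)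
  (hd : ∀ z ∈ O, 0 < (g z).det)
include hO hu hg

omit [Fintype ι] [DecidableEq ι] in
theorem contDiffOn_gram (i j : ι) : ContDiffOn ℝ ∞ (fun z => g z i j) O :=
  ((contDiffOn_fderiv_apply hO hu (e i)).inner ℝ (contDiffOn_fderiv_apply hO hu (e j))).congr
    fun z hz => (hg z hz i j).symm

include hd

/-- The Laplacian of an immersion `u` with respect to the metric it induces, here in the form
`∂ⱼ(√(det g) gⁱʲ ∂ᵢu)`, is normal to `u`. -/
theorem inner_laplacian_eq_zero {z : X} (hz : z ∈ O) (k : ι) :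
    inner ℝ (∑ i, ∑ j, fderiv ℝ (fun z => inverseMetricDensity (g z) i j • fderiv ℝ u z (e i)) z
      (e j)) (fderiv ℝ u z (e k)) = 0 := by
  have hO' := hO.mem_nhds hz
  have hgs := contDiffOn_gram hO hu hg
  have hsym : ∀ z ∈ O, ∀ i j, g z i j = g z j i := fun z hz i j => by
    rw [← hg z hz, ← hg z hz, real_inner_comm]
  have hdV : ∀ {F : X → V}, ContDiffOn ℝ ∞ F O → DifferentiableAt ℝ F z :=
    differentiableAt_of_contDiffOn hO hz
  have hdR : ∀ {F : X → ℝ}, ContDiffOn ℝ ∞ F O → DifferentiableAt ℝ F z :=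
    differentiableAt_of_contDiffOn hO hz
  have hc := fun i j => contDiffOn_inverseMetricDensity hgs hd i j
  have hu1 := fun i => contDiffOn_fderiv_apply hO hu (e i)
  have hcomm := fun i => fderiv_fderiv_apply_comm hO hu hz (e i) (e k)
  obtain ⟨c, hcdef⟩ : ∃ c : X → ι → ι → ℝ, ∀ z i j, inverseMetricDensity (g z) i j = c z i j :=
    ⟨_, fun _ _ _ => rfl⟩
  obtain ⟨u1, hu1def⟩ : ∃ u1 : ι → X → V, ∀ i z, fderiv ℝ u z (e i) = u1 i z :=
    ⟨_, fun _ _ => rfl⟩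
  have hcsymO : ∀ z ∈ O, ∀ i j, c z i j = c z j i := fun z hz i j => by
    simpa only [hcdef] using inverseMetricDensity_symm (hsym z hz) i j
  have hcg : ∀ z ∈ O, ∀ j k, ∑ i, c z j i * g z i k = if j = k then √(g z).det else 0 :=
    fun z hz j k => by simpa only [hcdef] using sum_inverseMetricDensity_mul (hd z hz).ne' j k
  have h7 := fderiv_sqrt_det (fun i j => hdR (hgs i j)) (hd z hz) (e k)
  simp only [hcdef, hu1def] at hc hu1 hcomm hg h7 ⊢
  have hcsym := hcsymO z hz
  have h1 : ∀ i j, inner ℝ (fderiv ℝ (fun z => c z i j • u1 i z) z (e j)) (u1 k z) =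
      fderiv ℝ (fun z => c z i j * g z i k) z (e j) -
        c z i j * inner ℝ (u1 i z) (fderiv ℝ (u1 k) z (e j)) := fun i j => by
    rw [eq_sub_iff_add_eq, ← real_inner_smul_left (u1 i z)]
    refine fderiv_inner_of_eventuallyEq (A := fun z => c z i j • u1 i z)
      (hdV ((hc i j).smul (hu1 i))) (hdV (hu1 k)) ?_ (e j)
    filter_upwards [hO'] with y hy
    rw [real_inner_smul_left, hg y hy]
  have h2 : ∀ j, ∑ i, fderiv ℝ (fun z => c z i j * g z i k) z (e j) =
      if j = k then fderiv ℝ (fun z => √(g z).det) z (e k) else 0 := fun j => by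
    have h3 : (fun z => ∑ i, c z i j * g z i k) =ᶠ[nhds z]
        fun z => if j = k then √(g z).det else 0 := by
      filter_upwards [hO'] with y hy
      rw [← hcg y hy]
      exact Finset.sum_congr rfl fun i _ => by rw [hcsymO y hy]
    have h4 := h3.fderiv_eq (𝕜 := ℝ)
    rw [fderiv_fun_sum fun i _ => hdR ((hc i j).mul (hgs i k))] at h4
    have h5 := congrArg (fun L : X →L[ℝ] ℝ => L (e j)) h4
    simp only [_root_.sum_apply] at h5
    rw [h5]
    split_ifs with hjk
    · rw [hjk]
    · simp
  -- Exchanging the two derivatives turns the last sum into a derivative of the Gram matrix.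
  have h6 : ∀ i j, fderiv ℝ (fun z => g z i j) z (e k) =
      inner ℝ (fderiv ℝ (u1 k) z (e i)) (u1 j z) + inner ℝ (u1 i z) (fderiv ℝ (u1 k) z (e j)) :=
    fun i j => by
      rw [← fderiv_inner_of_eventuallyEq (hdV (hu1 i)) (hdV (hu1 j))
        (by filter_upwards [hO'] with y hy using hg y hy i j) (e k), hcomm, hcomm]
  have h8 : ∑ i, ∑ j, c z i j * inner ℝ (fderiv ℝ (u1 k) z (e i)) (u1 j z) =
      ∑ i, ∑ j, c z i j * inner ℝ (u1 i z) (fderiv ℝ (u1 k) z (e j)) := by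
    rw [Finset.sum_comm]
    exact Finset.sum_congr rfl fun i _ => Finset.sum_congr rfl fun j _ => by
      rw [hcsym, real_inner_comm]
  simp only [sum_inner]
  simp only [h1, Finset.sum_sub_distrib]
  rw [Finset.sum_comm]
  simp only [h2]
  rw [Finset.sum_ite_eq' Finset.univ k, if_pos (Finset.mem_univ k), h7, sub_eq_zero]
  have h9 : ∑ i, ∑ j, c z j i * fderiv ℝ (fun z => g z i j) z (e k) =
      ∑ i, ∑ j, c z i j * fderiv ℝ (fun z => g z i j) z (e k) :=
    Finset.sum_congr rfl fun i _ => Finset.sum_congr rfl fun j _ => by rw [hcsym]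
  rw [h9]
  simp only [h6, mul_add, Finset.sum_add_distrib, h8]
  ring

/-- The variation of the mean curvature density under an isometric deformation is a divergence:
if the metric `g` is constant in the direction `τ`, then
`∂_τ (√(det g) gⁱʲ ⟪∂ᵢu, ∂ⱼn⟫) = ∂ⱼ (√(det g) gⁱʲ ⟪∂ᵢu, ∂_τ n⟫)`. -/
theorem fderiv_meanCurvatureDensity_eq_divergence [FiniteDimensional ℝ V]
    (hV : Module.finrank ℝ V = Fintype.card ι + 1) {n : X → V} (hn : ContDiffOn ℝ ∞ n O)
    (hun : ∀ z ∈ O, ∀ i, inner ℝ (fderiv ℝ u z (e i)) (n z) = 0) (hnn : ∀ z ∈ O, ‖n z‖ = 1)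
    {z τ : X} (hz : z ∈ O) (hτ : ∀ᶠ s in nhds (0 : ℝ), g (z + s • τ) = g z) :
    fderiv ℝ (fun z => ∑ i, ∑ j, inverseMetricDensity (g z) i j *
        inner ℝ (fderiv ℝ u z (e i)) (fderiv ℝ n z (e j))) z τ =
      ∑ j, fderiv ℝ (fun z => ∑ i, inverseMetricDensity (g z) i j *
        inner ℝ (fderiv ℝ u z (e i)) (fderiv ℝ n z τ)) z (e j) := by
  have hO' := hO.mem_nhds hz
  have hgs := contDiffOn_gram hO hu hg
  have hdV : ∀ {F : X → V}, ContDiffOn ℝ ∞ F O → DifferentiableAt ℝ F z :=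
    differentiableAt_of_contDiffOn hO hz
  have hdR : ∀ {F : X → ℝ}, ContDiffOn ℝ ∞ F O → DifferentiableAt ℝ F z :=
    differentiableAt_of_contDiffOn hO hz
  have hsym : ∀ i j, g z i j = g z j i := fun i j => by
    rw [← hg z hz, ← hg z hz, real_inner_comm]
  have hc := fun i j => contDiffOn_inverseMetricDensity hgs hd i j
  have hu1 := fun v => contDiffOn_fderiv_apply hO hu v
  have hn1 := fun v => contDiffOn_fderiv_apply hO hn v
  have hlap := inner_laplacian_eq_zero hO hu hg hd hz
  have hline : ∀ {F : Matrix ι ι ℝ → ℝ}, DifferentiableAt ℝ (fun z => F (g z)) z →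
      fderiv ℝ (fun z => F (g z)) z τ = 0 := fun {F} hF => by
    rw [← hF.lineDeriv_eq_fderiv, lineDeriv]
    have : (fun s : ℝ => F (g (z + s • τ))) =ᶠ[nhds 0] fun _ => F (g z) := by
      filter_upwards [hτ] with s hs
      rw [hs]
    rw [this.deriv_eq, deriv_const]
  have hcτ : ∀ i j, fderiv ℝ (fun z => inverseMetricDensity (g z) i j) z τ = 0 := fun i j =>
    hline (F := fun M => inverseMetricDensity M i j) (hdR (hc i j))
  have hgτ : ∀ i j, fderiv ℝ (fun z => g z i j) z τ = 0 := fun i j =>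
    hline (F := fun M => M i j) (hdR (hgs i j))
  have hcommu := fderiv_fderiv_apply_comm hO hu hz
  have hcommn := fderiv_fderiv_apply_comm hO hn hz
  have hcsym : ∀ i j, inverseMetricDensity (g z) i j = inverseMetricDensity (g z) j i :=
    inverseMetricDensity_symm hsym
  have hcinv : ∀ i j, inverseMetricDensity (g z) i j = √(g z).det * (g z)⁻¹ i j :=
    fun _ _ => rfl
  obtain ⟨c, hcdef⟩ : ∃ c : X → ι → ι → ℝ, ∀ z i j, inverseMetricDensity (g z) i j = c z i j :=
    ⟨_, fun _ _ _ => rfl⟩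
  obtain ⟨u1, hu1def⟩ : ∃ u1 : X → X → V, ∀ v z, fderiv ℝ u z v = u1 v z :=
    ⟨_, fun _ _ => rfl⟩
  obtain ⟨n1, hn1def⟩ : ∃ n1 : X → X → V, ∀ v z, fderiv ℝ n z v = n1 v z :=
    ⟨_, fun _ _ => rfl⟩
  simp only [hcdef, hu1def, hn1def] at hc hu1 hn1 hlap hcτ hcommu hcommn hcsym hcinv hg hun ⊢
  -- The derivatives of `n` are tangential.
  have hnt : ∀ v, inner ℝ (n1 v z) (n z) = 0 := fun v => by
    have h := fderiv_inner_of_eventuallyEq (hdV hn) (hdV hn) (k := fun _ => 1)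
      (by filter_upwards [hO'] with y hy; rw [real_inner_self_eq_norm_sq, hnn y hy, one_pow]) v
    rw [real_inner_comm] at h
    simp only [fderiv_fun_const, Pi.zero_apply, _root_.zero_apply] at h
    rw [real_inner_comm]
    rw [hn1def] at h
    linarith
  have hn0 : n z ≠ 0 := fun h => by simpa [h] using hnn z hz
  have htan : ∀ {w}, inner ℝ w (n z) = 0 →
      w = ∑ k, (∑ l, (g z)⁻¹ k l * inner ℝ (u1 (e l) z) w) • u1 (e k) z := fun hw =>
    eq_sum_inv_gram_smul hV (hg z hz) (hd z hz).ne' hn0 (hun z hz) hw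
  -- Symmetry of the second fundamental form.
  have hII : ∀ i j, inner ℝ (u1 (e i) z) (n1 (e j) z) = inner ℝ (u1 (e j) z) (n1 (e i) z) := by
    have h : ∀ i j, inner ℝ (fderiv ℝ (u1 (e i)) z (e j)) (n z) +
        inner ℝ (u1 (e i) z) (n1 (e j) z) = 0 := fun i j => by
      rw [← hn1def, fderiv_inner_of_eventuallyEq (hdV (hu1 (e i))) (hdV hn) (k := fun _ => 0)
        (by filter_upwards [hO'] with y hy using hun y hy i)]
      simp
    intro i j
    have h1 := h i j
    rw [hcommu] at h1
    have h2 := h j i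
    linarith
  have hskew : ∀ i j, inner ℝ (fderiv ℝ (u1 (e i)) z τ) (u1 (e j) z) +
      inner ℝ (fderiv ℝ (u1 (e j)) z τ) (u1 (e i) z) = 0 := fun i j => by
    rw [real_inner_comm _ (fderiv ℝ (u1 (e j)) z τ),
      fderiv_inner_of_eventuallyEq (hdV (hu1 (e i))) (hdV (hu1 (e j)))
      (by filter_upwards [hO'] with y hy using hg y hy i j), hgτ]
  -- The contraction of the antisymmetric `⟪∂_τ ∂ᵢu, ∂ₖu⟫` with the symmetric shape operator.
  have hzero : ∑ i, ∑ j, c z i j * inner ℝ (fderiv ℝ (u1 (e i)) z τ) (n1 (e j) z) = 0 := by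
    have h1 : ∀ i j, c z i j * inner ℝ (fderiv ℝ (u1 (e i)) z τ) (n1 (e j) z) =
        ∑ k, c z i j * (∑ l, (g z)⁻¹ k l * inner ℝ (u1 (e l) z) (n1 (e j) z)) *
          inner ℝ (fderiv ℝ (u1 (e i)) z τ) (u1 (e k) z) := fun i j => by
      conv_lhs => rw [htan (hnt (e j)), inner_sum, Finset.mul_sum]
      simp only [inner_smul_right, mul_assoc]
    simp only [h1]
    rw [Finset.sum_congr rfl fun i _ => Finset.sum_comm]
    simp only [← Finset.sum_mul]
    refine sum_mul_eq_zero_of_symm_of_antisymm (fun i k => ?_) hskew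
    simp only [Finset.mul_sum]
    rw [Finset.sum_comm]
    have hgi : ∀ i j, (g z)⁻¹ i j = c z i j / √(g z).det := fun i j => by
      rw [hcinv, mul_div_cancel_left₀ _ (Real.sqrt_pos.2 (hd z hz)).ne']
    refine Finset.sum_congr rfl fun l _ => Finset.sum_congr rfl fun j _ => ?_
    rw [hgi, hgi, hII l j]
    ring
  have hzero' : ∑ i, ∑ j, inner ℝ (fderiv ℝ (fun z => c z i j • u1 (e i) z) z (e j)) (n1 τ z)
      = 0 := by
    simp only [← sum_inner]
    rw [htan (hnt τ), inner_sum]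
    refine Finset.sum_eq_zero fun k _ => ?_
    rw [inner_smul_right, hlap, mul_zero]
  have hL : fderiv ℝ (fun z => ∑ i, ∑ j, c z i j * inner ℝ (u1 (e i) z) (n1 (e j) z)) z τ =
      ∑ i, ∑ j, c z i j * (inner ℝ (fderiv ℝ (u1 (e i)) z τ) (n1 (e j) z) +
        inner ℝ (u1 (e i) z) (fderiv ℝ (n1 (e j)) z τ)) := by
    have hin := fun i j => (hu1 (e i)).inner ℝ (hn1 (e j))
    rw [fderiv_fun_sum fun i _ => hdR (ContDiffOn.sum fun j _ => (hc i j).mul (hin i j)),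
      _root_.sum_apply]
    refine Finset.sum_congr rfl fun i _ => ?_
    rw [fderiv_fun_sum fun j _ => hdR ((hc i j).mul (hin i j)), _root_.sum_apply]
    refine Finset.sum_congr rfl fun j _ => ?_
    rw [fderiv_fun_mul (hdR (hc i j)) (hdR (hin i j)), _root_.add_apply,
      _root_.smul_apply, _root_.smul_apply, hcτ, smul_zero, add_zero, smul_eq_mul,
      fderiv_inner_of_eventuallyEq (hdV (hu1 (e i))) (hdV (hn1 (e j)))
        (Filter.Eventually.of_forall fun _ => rfl)]
  have hR : ∀ j, fderiv ℝ (fun z => ∑ i, c z i j * inner ℝ (u1 (e i) z) (n1 τ z)) z (e j) =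
      ∑ i, (inner ℝ (fderiv ℝ (fun z => c z i j • u1 (e i) z) z (e j)) (n1 τ z) +
        c z i j * inner ℝ (u1 (e i) z) (fderiv ℝ (n1 (e j)) z τ)) := fun j => by
    have hin := fun i => (hu1 (e i)).inner ℝ (hn1 τ)
    rw [fderiv_fun_sum fun i _ => hdR ((hc i j).mul (hin i)), _root_.sum_apply]
    refine Finset.sum_congr rfl fun i _ => ?_
    rw [hcommn (e j) τ, ← real_inner_smul_left,
      fderiv_inner_of_eventuallyEq (A := fun z => c z i j • u1 (e i) z)
        (hdV ((hc i j).smul (hu1 (e i)))) (hdV (hn1 τ))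
        (Filter.Eventually.of_forall fun y => real_inner_smul_left _ _ _)]
  refine hL.trans ?_
  rw [Finset.sum_congr rfl fun j _ => hR j, Finset.sum_comm (s := Finset.univ)
    (f := fun j i => inner ℝ (fderiv ℝ (fun z => c z i j • u1 (e i) z) z (e j)) (n1 τ z) +
        c z i j * inner ℝ (u1 (e i) z) (fderiv ℝ (n1 (e j)) z τ))]
  simp only [mul_add, Finset.sum_add_distrib, hzero, hzero']

end Divergence

end Variation

/-! ### Calculus on `[0, 1] × U` -/

section Slab

variable {E V W : Type*} [NormedAddCommGroup E] [NormedSpace ℝ E] [NormedAddCommGroup V]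
  [InnerProductSpace ℝ V] [NormedAddCommGroup W] [NormedSpace ℝ W] {ι : Type*} [Fintype ι]
  [DecidableEq ι] {U : Set E}

/-- The derivative of `F (t, y)` with respect to `y`, in the direction `v`. -/
def spatialDeriv (v : E) (F : ℝ × E → W) (z : ℝ × E) : W :=
  fderiv ℝ (fun y => F (z.1, y)) z.2 v

theorem uniqueDiffOn_slab (hU : IsOpen U) : UniqueDiffOn ℝ (Set.Icc (0 : ℝ) 1 ×ˢ U) :=
  (uniqueDiffOn_Icc zero_lt_one).prod hU.uniqueDiffOn

theorem spatialDeriv_eq_fderivWithin (hU : IsOpen U) {F : ℝ × E → W}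
    (hF : ContDiffOn ℝ ∞ F (Set.Icc 0 1 ×ˢ U)) {z : ℝ × E} (hz : z ∈ Set.Icc (0 : ℝ) 1 ×ˢ U)
    (v : E) : spatialDeriv v F z = fderivWithin ℝ F (Set.Icc 0 1 ×ˢ U) z (0, v) := by
  have h1 : HasFDerivWithinAt F (fderivWithin ℝ F (Set.Icc 0 1 ×ˢ U) z) (Set.Icc 0 1 ×ˢ U)
      (z.1, z.2) := (hF.differentiableOn (by simp) z hz).hasFDerivWithinAt
  have h2 := (h1.comp z.2 (hasFDerivAt_prodMk_right z.1 z.2).hasFDerivWithinAt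
    (s := U) fun y hy => ⟨hz.1, hy⟩).hasFDerivAt (hU.mem_nhds hz.2)
  exact congrArg (fun L : E →L[ℝ] W => L v) h2.fderiv

theorem contDiffOn_spatialDeriv (hU : IsOpen U) {F : ℝ × E → W}
    (hF : ContDiffOn ℝ ∞ F (Set.Icc 0 1 ×ˢ U)) (v : E) :
    ContDiffOn ℝ ∞ (spatialDeriv v F) (Set.Icc 0 1 ×ˢ U) :=
  ((hF.fderivWithin (uniqueDiffOn_slab hU) (by simp)).clm_apply contDiffOn_const).congr
    fun _ hz => spatialDeriv_eq_fderivWithin hU hF hz v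

omit [NormedSpace ℝ E] in
theorem slab_mem_nhds (hU : IsOpen U) {z : ℝ × E} (hz : z ∈ Set.Ioo (0 : ℝ) 1 ×ˢ U) :
    Set.Icc (0 : ℝ) 1 ×ˢ U ∈ nhds z :=
  Filter.mem_of_superset ((isOpen_Ioo.prod hU).mem_nhds hz)
    (Set.prod_mono Set.Ioo_subset_Icc_self subset_rfl)

theorem spatialDeriv_eq_fderiv (hU : IsOpen U) {F : ℝ × E → W}
    (hF : ContDiffOn ℝ ∞ F (Set.Icc 0 1 ×ˢ U)) {z : ℝ × E} (hz : z ∈ Set.Ioo (0 : ℝ) 1 ×ˢ U)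
    (v : E) : spatialDeriv v F z = fderiv ℝ F z (0, v) := by
  rw [spatialDeriv_eq_fderivWithin hU hF ⟨Set.Ioo_subset_Icc_self hz.1, hz.2⟩,
    fderivWithin_of_mem_nhds (slab_mem_nhds hU hz)]

theorem hasDerivAt_time (hU : IsOpen U) {F : ℝ × E → W}
    (hF : ContDiffOn ℝ ∞ F (Set.Icc 0 1 ×ˢ U)) {z : ℝ × E} (hz : z ∈ Set.Ioo (0 : ℝ) 1 ×ˢ U) :
    HasDerivAt (fun s => F (s, z.2)) (fderiv ℝ F z (1, 0)) z.1 := by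
  have h1 : HasFDerivAt F (fderiv ℝ F z) (z.1, z.2) :=
    ((hF.contDiffAt (slab_mem_nhds hU hz)).differentiableAt (by simp)).hasFDerivAt
  exact h1.comp_hasDerivAt z.1 ((hasDerivAt_id z.1).prodMk (hasDerivAt_const z.1 z.2))

/-- An isometric deformation of an immersed hypersurface `u` with unit normal `n`, read in
coordinates: `u` and `n` are functions of `(t, y) ∈ [0, 1] × U`, the coordinate vectors are `e`,
and the Gram matrix `g` of the first fundamental form depends on `y` only. -/
structure IsBendingInCoordinates (U : Set E) (e : ι → E) (g : E → Matrix ι ι ℝ)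
    (u n : ℝ × E → V) : Prop where
  isOpen : IsOpen U
  smooth : ContDiffOn ℝ ∞ u (Set.Icc 0 1 ×ˢ U)
  continuousOn_normal : ContinuousOn n (Set.Icc 0 1 ×ˢ U)
  gram : ∀ z ∈ Set.Icc (0 : ℝ) 1 ×ˢ U, ∀ i j,
    inner ℝ (spatialDeriv (e i) u z) (spatialDeriv (e j) u z) = g z.2 i j
  det_pos : ∀ y ∈ U, 0 < (g y).det
  orthogonal : ∀ z ∈ Set.Icc (0 : ℝ) 1 ×ˢ U, ∀ i, inner ℝ (spatialDeriv (e i) u z) (n z) = 0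
  norm_eq_one : ∀ z ∈ Set.Icc (0 : ℝ) 1 ×ˢ U, ‖n z‖ = 1

namespace IsBendingInCoordinates

variable {e : ι → E} {g : E → Matrix ι ι ℝ} {u n : ℝ × E → V}
  (h : IsBendingInCoordinates U e g u n)
include h

theorem contDiffOn_metric (i j : ι) : ContDiffOn ℝ ∞ (fun y => g y i j) U := by
  have h1 : ContDiffOn ℝ ∞ (fun z : ℝ × E => g z.2 i j) (Set.Icc 0 1 ×ˢ U) :=
    ((contDiffOn_spatialDeriv h.isOpen h.smooth (e i)).inner ℝ
      (contDiffOn_spatialDeriv h.isOpen h.smooth (e j))).congr fun z hz => (h.gram z hz i j).symm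
  exact h1.comp (f := fun y : E => ((0 : ℝ), y)) (contDiff_prodMk_right _).contDiffOn
    fun y hy => ⟨⟨le_rfl, zero_le_one⟩, hy⟩

/-- A continuous unit normal field of a smooth family of immersions is smooth: near a point `z₀` it
is the normalisation of the normal component of its value at `z₀`. -/
theorem contDiffOn_normal [FiniteDimensional ℝ V]
    (hV : Module.finrank ℝ V = Fintype.card ι + 1) :
    ContDiffOn ℝ ∞ n (Set.Icc 0 1 ×ˢ U) := by
  intro z₀ hz₀
  have hu1 := fun i => contDiffOn_spatialDeriv h.isOpen h.smooth (e i)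
  have hgi : ∀ i j, ContDiffOn ℝ ∞ (fun z : ℝ × E => (g z.2)⁻¹ i j) (Set.Icc 0 1 ×ˢ U) :=
    fun i j => (contDiffOn_inv_apply h.contDiffOn_metric (fun y hy => (h.det_pos y hy).ne') i
      j).comp contDiff_snd.contDiffOn fun z hz => hz.2
  set N : ℝ × E → V := fun z => n z₀ -
    ∑ k, (∑ l, (g z.2)⁻¹ k l * inner ℝ (spatialDeriv (e l) u z) (n z₀)) •
      spatialDeriv (e k) u z with hN
  have hNs : ContDiffOn ℝ ∞ N (Set.Icc 0 1 ×ˢ U) :=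
    contDiffOn_const.sub (ContDiffOn.sum fun k _ =>
      (ContDiffOn.sum fun l _ => (hgi k l).mul ((hu1 l).inner ℝ contDiffOn_const)).smul (hu1 k))
  have hNn : ∀ z ∈ Set.Icc (0 : ℝ) 1 ×ˢ U, N z = (inner ℝ (n z₀) (n z) : ℝ) • n z := by
    intro z hz
    have hnz : inner ℝ (n z) (n z) = (1 : ℝ) := by
      rw [real_inner_self_eq_norm_sq, h.norm_eq_one z hz, one_pow]
    have hn0 : n z ≠ 0 := fun h0 => by simpa [h0] using h.norm_eq_one z hz
    have hw : inner ℝ (n z₀ - (inner ℝ (n z₀) (n z) : ℝ) • n z) (n z) = 0 := by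
      rw [inner_sub_left, real_inner_smul_left, hnz, mul_one, sub_self]
    have h1 := eq_sum_inv_gram_smul hV (h.gram z hz) (h.det_pos z.2 hz.2).ne' hn0
      (h.orthogonal z hz) hw
    have h2 : ∀ l, inner ℝ (spatialDeriv (e l) u z) (n z₀ - (inner ℝ (n z₀) (n z) : ℝ) • n z) =
        inner ℝ (spatialDeriv (e l) u z) (n z₀) := fun l => by
      rw [inner_sub_right, real_inner_smul_right, h.orthogonal z hz, mul_zero, sub_zero]
    simp only [h2] at h1
    rw [hN]
    simp only
    rw [← h1, sub_sub_cancel]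
  have hN0 : N z₀ ≠ 0 := by
    rw [hNn z₀ hz₀, real_inner_self_eq_norm_sq, h.norm_eq_one z₀ hz₀, one_pow, one_smul]
    exact fun h0 => by simpa [h0] using h.norm_eq_one z₀ hz₀
  have hpos : ∀ᶠ z in nhdsWithin z₀ (Set.Icc 0 1 ×ˢ U), 0 < (inner ℝ (n z₀) (n z) : ℝ) := by
    have h3 : ContinuousWithinAt (fun z => (inner ℝ (n z₀) (n z) : ℝ)) (Set.Icc 0 1 ×ˢ U) z₀ :=
      continuousWithinAt_const.inner (𝕜 := ℝ) (h.continuousOn_normal z₀ hz₀)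
    refine h3.eventually (lt_mem_nhds ?_)
    beta_reduce
    rw [real_inner_self_eq_norm_sq, h.norm_eq_one z₀ hz₀]
    norm_num
  have heq : ∀ᶠ z in nhdsWithin z₀ (Set.Icc 0 1 ×ˢ U), n z = ‖N z‖⁻¹ • N z := by
    filter_upwards [hpos, self_mem_nhdsWithin] with z hz1 hz
    rw [hNn z hz, norm_smul, h.norm_eq_one z hz, mul_one, Real.norm_of_nonneg hz1.le,
      inv_smul_smul₀ hz1.ne']
  have hNz := hNs z₀ hz₀
  exact (((hNz.norm ℝ hN0).inv (norm_ne_zero_iff.2 hN0)).smul hNz).congr_of_eventuallyEq_of_mem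
    heq hz₀

end IsBendingInCoordinates

end Slab

/-! ### Integrals of compactly supported functions -/

section Integrals

open MeasureTheory

variable {E W : Type*} [NormedAddCommGroup E] [NormedAddCommGroup W]
  {U K : Set E}

theorem continuousOn_prod_indicator {T : Set ℝ} (hU : IsOpen U) (hK : IsClosed K) (hKU : K ⊆ U)
    {h : ℝ × E → W} (hc : ContinuousOn h (T ×ˢ U)) (h0 : ∀ z ∈ T ×ˢ U, z.2 ∉ K → h z = 0) :
    ContinuousOn (fun z : ℝ × E => U.indicator (fun y => h (z.1, y)) z.2) (T ×ˢ Set.univ) := by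
  rintro z ⟨hz, -⟩
  by_cases hzU : z.2 ∈ U
  · have h1 : ContinuousWithinAt h (T ×ˢ Set.univ) z := by
      refine (hc z ⟨hz, hzU⟩).mono_of_mem_nhdsWithin ?_
      have h2 : Set.univ ×ˢ U ∈ nhds z := (isOpen_univ.prod hU).mem_nhds ⟨trivial, hzU⟩
      filter_upwards [self_mem_nhdsWithin, mem_nhdsWithin_of_mem_nhds h2] with y hy1 hy2
      exact ⟨hy1.1, hy2.2⟩
    refine h1.congr_of_eventuallyEq ?_ (Set.indicator_of_mem hzU _)
    have h2 : Set.univ ×ˢ U ∈ nhds z := (isOpen_univ.prod hU).mem_nhds ⟨trivial, hzU⟩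
    filter_upwards [mem_nhdsWithin_of_mem_nhds h2] with y hy
    exact Set.indicator_of_mem hy.2 _
  · have h2 : Set.univ ×ˢ Kᶜ ∈ nhds z :=
      (isOpen_univ.prod hK.isOpen_compl).mem_nhds ⟨trivial, fun hk => hzU (hKU hk)⟩
    have h3 : ∀ y ∈ T ×ˢ Set.univ, y ∈ Set.univ ×ˢ Kᶜ →
        U.indicator (fun x => h (y.1, x)) y.2 = 0 := fun y hy1 hy => by
      by_cases hyU : y.2 ∈ U
      · rw [Set.indicator_of_mem hyU]
        exact h0 _ ⟨hy1.1, hyU⟩ hy.2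
      · exact Set.indicator_of_notMem hyU _
    refine continuousWithinAt_const.congr_of_eventuallyEq ?_
      (h3 z ⟨hz, trivial⟩ (mem_of_mem_nhds h2))
    filter_upwards [self_mem_nhdsWithin, mem_nhdsWithin_of_mem_nhds h2] with y hy1 hy
    exact h3 y hy1 hy

theorem continuous_indicator_of_compact (hU : IsOpen U) (hK : IsClosed K) (hKU : K ⊆ U)
    {h : E → W} (hc : ContinuousOn h U) (h0 : ∀ y ∈ U, y ∉ K → h y = 0) :
    Continuous (U.indicator h) := by
  have h1 := continuousOn_prod_indicator (T := {0}) hU hK hKU (h := fun z => h z.2)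
    (hc.comp continuousOn_snd fun z hz => hz.2) fun z hz => h0 z.2 hz.2
  rw [← continuousOn_univ]
  exact h1.comp (f := fun y : E => ((0 : ℝ), y)) (by fun_prop) fun y _ => ⟨rfl, trivial⟩

theorem hasCompactSupport_indicator (hK : IsCompact K)
    {h : E → W} (h0 : ∀ y ∈ U, y ∉ K → h y = 0) : HasCompactSupport (U.indicator h) := by
  refine HasCompactSupport.intro hK fun y hy => ?_
  by_cases hyU : y ∈ U
  · rw [Set.indicator_of_mem hyU, h0 y hyU hy]
  · exact Set.indicator_of_notMem hyU _

variable [MeasurableSpace E] [BorelSpace E] {μ : Measure E} [IsFiniteMeasureOnCompacts μ]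

theorem integrableOn_of_compact (hU : IsOpen U) (hK : IsCompact K) (hKU : K ⊆ U)
    {h : E → W} (hc : ContinuousOn h U) (h0 : ∀ y ∈ U, y ∉ K → h y = 0) :
    IntegrableOn h U μ := by
  rw [← integrable_indicator_iff hU.measurableSet]
  exact (continuous_indicator_of_compact hU hK.isClosed hKU hc h0).integrable_of_hasCompactSupport
    (hasCompactSupport_indicator hK h0)

variable [NormedSpace ℝ W]

theorem continuousOn_integral_of_compact {T : Set ℝ} (hU : IsOpen U) (hK : IsCompact K)
    (hKU : K ⊆ U) {h : ℝ × E → W} (hc : ContinuousOn h (T ×ˢ U))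
    (h0 : ∀ z ∈ T ×ˢ U, z.2 ∉ K → h z = 0) :
    ContinuousOn (fun t => ∫ y in U, h (t, y) ∂μ) T := by
  simp only [← integral_indicator hU.measurableSet]
  refine continuousOn_integral_of_compact_support hK
    (continuousOn_prod_indicator hU hK.isClosed hKU hc h0) fun t y ht hy => ?_
  by_cases hyU : y ∈ U
  · rw [Set.indicator_of_mem hyU]
    exact h0 (t, y) ⟨ht, hyU⟩ hy
  · exact Set.indicator_of_notMem hyU _

theorem hasDerivAt_integral_of_compact {T : Set ℝ} (hT : IsOpen T) (hU : IsOpen U)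
    (hK : IsCompact K) (hKU : K ⊆ U) {h h' : ℝ × E → W} (hc : ContinuousOn h (T ×ˢ U))
    (hc' : ContinuousOn h' (T ×ˢ U)) (h0 : ∀ z ∈ T ×ˢ U, z.2 ∉ K → h z = 0)
    (h0' : ∀ z ∈ T ×ˢ U, z.2 ∉ K → h' z = 0)
    (hd : ∀ z ∈ T ×ˢ U, HasDerivAt (fun s => h (s, z.2)) (h' z) z.1) {t : ℝ} (ht : t ∈ T) :
    HasDerivAt (fun t => ∫ y in U, h (t, y) ∂μ) (∫ y in U, h' (t, y) ∂μ) t := by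
  obtain ⟨ε, hε, hεT⟩ := Metric.nhds_basis_closedBall.mem_iff.1 (hT.mem_nhds ht)
  have hslice : ∀ {k : ℝ × E → W}, ContinuousOn k (T ×ˢ U) → ∀ s ∈ T,
      ContinuousOn (fun y => k (s, y)) U := fun hk s hs =>
    hk.comp (f := fun y : E => (s, y)) (by fun_prop) fun y hy => ⟨hs, hy⟩
  obtain ⟨C, hC⟩ := ((isCompact_closedBall t ε).prod hK).exists_bound_of_continuousOn
    (hc'.mono (Set.prod_mono hεT hKU))
  have hint : ∀ {k : ℝ × E → W}, ContinuousOn k (T ×ˢ U) →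
      (∀ z ∈ T ×ˢ U, z.2 ∉ K → k z = 0) → ∀ s ∈ T, IntegrableOn (fun y => k (s, y)) U μ :=
    fun hk hk0 s hs => integrableOn_of_compact hU hK hKU (hslice hk s hs)
      fun y hy => hk0 (s, y) ⟨hs, hy⟩
  refine (hasDerivAt_integral_of_dominated_loc_of_deriv_le (F := fun s y => h (s, y))
    (F' := fun s y => h' (s, y)) (μ := μ.restrict U) (bound := K.indicator fun _ => C)
    (Metric.closedBall_mem_nhds t hε) ?_ (hint hc h0 t ht)
    (hint hc' h0' t ht).aestronglyMeasurable ?_ ?_ ?_).2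
  · filter_upwards [hT.mem_nhds ht] with s hs
    exact (hint hc h0 s hs).aestronglyMeasurable
  · refine (ae_restrict_iff' hU.measurableSet).2 (Filter.Eventually.of_forall fun y hy s hs => ?_)
    by_cases hyK : y ∈ K
    · rw [Set.indicator_of_mem hyK]
      exact hC (s, y) ⟨hs, hyK⟩
    · rw [Set.indicator_of_notMem hyK, h0' (s, y) ⟨hεT hs, hy⟩ hyK, norm_zero]
  · rw [integrable_indicator_iff hK.measurableSet]
    exact integrableOn_const (hs := ((Measure.restrict_apply_le _ _).trans_lt hK.measure_lt_top).ne)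
  · refine (ae_restrict_iff' hU.measurableSet).2 (Filter.Eventually.of_forall fun y hy s hs => ?_)
    exact hd (s, y) ⟨hεT hs, hy⟩

end Integrals

section Divergence

open MeasureTheory

variable {E : Type*} [NormedAddCommGroup E] [NormedSpace ℝ E] [FiniteDimensional ℝ E]
  [MeasurableSpace E] [BorelSpace E] {μ : Measure E} [μ.IsAddHaarMeasure] {U K : Set E}

/-- The divergence theorem for compactly supported functions on an open set. -/
theorem integral_fderiv_eq_zero_of_compact (hU : IsOpen U) (hK : IsCompact K) (hKU : K ⊆ U)
    {h : E → ℝ} (hc : ContDiffOn ℝ ∞ h U) (h0 : ∀ y ∈ U, y ∉ K → h y = 0) (v : E) :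
    ∫ y in U, fderiv ℝ h y v ∂μ = 0 := by
  have heq : ∀ y ∈ U, U.indicator h =ᶠ[nhds y] h := fun y hy => by
    filter_upwards [hU.mem_nhds hy] with x hx using Set.indicator_of_mem hx _
  have heq0 : ∀ y ∉ K, U.indicator h =ᶠ[nhds y] fun _ => 0 := fun y hy => by
    filter_upwards [hK.isClosed.isOpen_compl.mem_nhds hy] with x hx
    by_cases hxU : x ∈ U
    · rw [Set.indicator_of_mem hxU, h0 x hxU hx]
    · exact Set.indicator_of_notMem hxU _
  have hsm : ContDiff ℝ ∞ (U.indicator h) := contDiff_iff_contDiffAt.2 fun y => by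
    by_cases hy : y ∈ K
    · exact (hc.contDiffAt (hU.mem_nhds (hKU hy))).congr_of_eventuallyEq (heq y (hKU hy))
    · exact contDiffAt_const.congr_of_eventuallyEq (heq0 y hy)
  have hcs := hasCompactSupport_indicator hK h0
  have hfd : (fun y => fderiv ℝ (U.indicator h) y v) = U.indicator fun y => fderiv ℝ h y v := by
    funext y
    by_cases hy : y ∈ U
    · rw [Set.indicator_of_mem hy, (heq y hy).fderiv_eq]
    · rw [Set.indicator_of_notMem hy, (heq0 y fun hk => hy (hKU hk)).fderiv_eq]
      simp
  rw [← integral_indicator hU.measurableSet, ← hfd]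
  have hi : Integrable (fun y => fderiv ℝ (U.indicator h) y v) μ :=
    ((hsm.continuous_fderiv (by simp)).clm_apply continuous_const).integrable_of_hasCompactSupport
      (hcs.fderiv_apply ℝ v)
  have := integral_mul_fderiv_eq_neg_fderiv_mul_of_integrable (μ := μ) (f := fun _ : E => (1 : ℝ))
    (g := U.indicator h) (v := v) (by simp) (by simpa using hi)
    (by simpa using hsm.continuous.integrable_of_hasCompactSupport hcs)
    (fun x _ => differentiableAt_const _) (fun x _ => hsm.differentiable (by simp) x)
  simpa using this

end Divergence

/-! ### The variation of the total mean curvature in a chart -/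

section ChartVariation

open MeasureTheory

variable {E V : Type*} [NormedAddCommGroup E] [NormedSpace ℝ E] [NormedAddCommGroup V]
  [InnerProductSpace ℝ V] {ι : Type*} [Fintype ι] [DecidableEq ι]

theorem fderiv_apply_eq_zero_of_notMem {U K : Set E} (hU : IsOpen U) (hK : IsClosed K) {φ : E → ℝ}
    (hφ0 : ∀ y ∈ U, y ∉ K → φ y = 0) {y : E} (hy : y ∈ U) (hyK : y ∉ K) (v : E) :
    fderiv ℝ φ y v = 0 := by
  have : φ =ᶠ[nhds y] fun _ => 0 := by
    filter_upwards [hU.mem_nhds hy, hK.isOpen_compl.mem_nhds hyK] with x hx hxK using hφ0 x hx hxK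
  rw [this.fderiv_eq]
  simp

/-- The expression `√(det g) gⁱʲ ⟪∂ᵢu, ∂ⱼn⟫`, equal to `-H √(det g)`. -/
def meanCurvatureDensity (e : ι → E) (g : E → Matrix ι ι ℝ) (u n : ℝ × E → V) (z : ℝ × E) : ℝ :=
  ∑ i, ∑ j, inverseMetricDensity (g z.2) i j *
    inner ℝ (spatialDeriv (e i) u z) (spatialDeriv (e j) n z)

/-- The component `√(det g) gⁱʲ ⟪∂ᵢu, ∂ₜn⟫` of the vector field `√(det g) W`, where `W` is the
tangent vector field with `du(W) = ∂ₜn`. -/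
def normalVelocityDensity (e : ι → E) (g : E → Matrix ι ι ℝ) (u n : ℝ × E → V) (j : ι)
    (z : ℝ × E) : ℝ :=
  ∑ i, inverseMetricDensity (g z.2) i j * inner ℝ (spatialDeriv (e i) u z) (fderiv ℝ n z (1, 0))

namespace IsBendingInCoordinates

variable {U K : Set E} {e : ι → E} {g : E → Matrix ι ι ℝ} {u n : ℝ × E → V} [FiniteDimensional ℝ V]
  (h : IsBendingInCoordinates U e g u n) (hV : Module.finrank ℝ V = Fintype.card ι + 1)
include h hV

theorem contDiffOn_meanCurvatureDensity :
    ContDiffOn ℝ ∞ (meanCurvatureDensity e g u n) (Set.Icc 0 1 ×ˢ U) :=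
  ContDiffOn.sum fun i _ => ContDiffOn.sum fun j _ =>
    ((contDiffOn_inverseMetricDensity h.contDiffOn_metric h.det_pos i j).comp
      contDiff_snd.contDiffOn fun _ hz => hz.2).mul
    ((contDiffOn_spatialDeriv h.isOpen h.smooth (e i)).inner ℝ
      (contDiffOn_spatialDeriv h.isOpen (h.contDiffOn_normal hV) (e j)))

theorem contDiffOn_normalVelocityDensity (j : ι) :
    ContDiffOn ℝ ∞ (normalVelocityDensity e g u n j) (Set.Ioo 0 1 ×ˢ U) :=
  have hs : Set.Ioo (0 : ℝ) 1 ×ˢ U ⊆ Set.Icc 0 1 ×ˢ U :=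
    Set.prod_mono Set.Ioo_subset_Icc_self subset_rfl
  ContDiffOn.sum fun i _ =>
    ((contDiffOn_inverseMetricDensity h.contDiffOn_metric h.det_pos i j).comp
      contDiff_snd.contDiffOn fun _ hz => hz.2).mul
    (((contDiffOn_spatialDeriv h.isOpen h.smooth (e i)).mono hs).inner ℝ
      (contDiffOn_fderiv_apply (isOpen_Ioo.prod h.isOpen) ((h.contDiffOn_normal hV).mono hs) _))

theorem fderiv_meanCurvatureDensity {z : ℝ × E} (hz : z ∈ Set.Ioo (0 : ℝ) 1 ×ˢ U) :
    fderiv ℝ (meanCurvatureDensity e g u n) z (1, 0) =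
      ∑ j, fderiv ℝ (normalVelocityDensity e g u n j) z (0, e j) := by
  have hO : IsOpen (Set.Ioo (0 : ℝ) 1 ×ˢ U) := isOpen_Ioo.prod h.isOpen
  have hs : Set.Ioo (0 : ℝ) 1 ×ˢ U ⊆ Set.Icc 0 1 ×ˢ U :=
    Set.prod_mono Set.Ioo_subset_Icc_self subset_rfl
  have hn := h.contDiffOn_normal hV
  have hu1 : ∀ y ∈ Set.Ioo (0 : ℝ) 1 ×ˢ U, ∀ i,
      fderiv ℝ u y (0, e i) = spatialDeriv (e i) u y := fun y hy i =>
    (spatialDeriv_eq_fderiv h.isOpen h.smooth hy (e i)).symm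
  have hn1 : ∀ y ∈ Set.Ioo (0 : ℝ) 1 ×ˢ U, ∀ i,
      fderiv ℝ n y (0, e i) = spatialDeriv (e i) n y := fun y hy i =>
    (spatialDeriv_eq_fderiv h.isOpen hn hy (e i)).symm
  have key := fderiv_meanCurvatureDensity_eq_divergence hO (h.smooth.mono hs)
    (g := fun z => g z.2) (e := fun i => (0, e i)) (τ := (1, 0))
    (fun y hy i j => by rw [hu1 y hy, hu1 y hy, h.gram y (hs hy)])
    (fun y hy => h.det_pos y.2 hy.2) hV (hn.mono hs)
    (fun y hy i => by rw [hu1 y hy, h.orthogonal y (hs hy)])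
    (fun y hy => h.norm_eq_one y (hs hy)) hz (Filter.Eventually.of_forall fun s => by simp)
  have h1 : meanCurvatureDensity e g u n =ᶠ[nhds z] fun z =>
      ∑ i, ∑ j, inverseMetricDensity (g z.2) i j *
        inner ℝ (fderiv ℝ u z (0, e i)) (fderiv ℝ n z (0, e j)) := by
    filter_upwards [hO.mem_nhds hz] with y hy
    simp only [meanCurvatureDensity, hu1 y hy, hn1 y hy]
  have h2 : ∀ j, normalVelocityDensity e g u n j =ᶠ[nhds z] fun z =>
      ∑ i, inverseMetricDensity (g z.2) i j *
        inner ℝ (fderiv ℝ u z (0, e i)) (fderiv ℝ n z (1, 0)) := fun j => by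
    filter_upwards [hO.mem_nhds hz] with y hy
    simp only [normalVelocityDensity, hu1 y hy]
  rw [h1.fderiv_eq, key]
  exact Finset.sum_congr rfl fun j _ => by rw [(h2 j).fderiv_eq]

theorem continuousOn_sum_normalVelocityDensity {φ : E → ℝ}
    (hφ : ContDiffOn ℝ ∞ φ U) {t : ℝ} (ht : t ∈ Set.Ioo (0 : ℝ) 1) :
    ContinuousOn (fun y => ∑ j, fderiv ℝ φ y (e j) * normalVelocityDensity e g u n j (t, y)) U :=
  continuousOn_finsetSum _ fun j _ =>
    (contDiffOn_fderiv_apply h.isOpen hφ (e j)).continuousOn.mul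
      ((h.contDiffOn_normalVelocityDensity hV j).continuousOn.comp
        (f := fun y : E => (t, y)) (by fun_prop) fun y hy => ⟨ht, hy⟩)

variable [MeasurableSpace E] [BorelSpace E] {μ : Measure E} {φ : E → ℝ} (hK : IsCompact K)
  (hKU : K ⊆ U) (hφ : ContDiffOn ℝ ∞ φ U) (hφ0 : ∀ y ∈ U, y ∉ K → φ y = 0)
include hK hKU hφ hφ0

theorem continuousOn_integral_meanCurvatureDensity [IsFiniteMeasureOnCompacts μ] :
    ContinuousOn (fun t => ∫ y in U, φ y * meanCurvatureDensity e g u n (t, y) ∂μ)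
      (Set.Icc 0 1) :=
  continuousOn_integral_of_compact (h := fun z => φ z.2 * meanCurvatureDensity e g u n z)
    h.isOpen hK hKU
    ((hφ.continuousOn.comp continuousOn_snd fun z hz => hz.2).mul
      (h.contDiffOn_meanCurvatureDensity hV).continuousOn)
    fun z hz hzK => by rw [hφ0 z.2 hz.2 hzK, zero_mul]

theorem integrableOn_meanCurvatureDensity [IsFiniteMeasureOnCompacts μ] {t : ℝ}
    (ht : t ∈ Set.Icc (0 : ℝ) 1) :
    IntegrableOn (fun y => φ y * meanCurvatureDensity e g u n (t, y)) U μ :=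
  integrableOn_of_compact h.isOpen hK hKU
    (hφ.continuousOn.mul ((h.contDiffOn_meanCurvatureDensity hV).continuousOn.comp
      (f := fun y : E => (t, y)) (by fun_prop) fun y hy => ⟨ht, hy⟩))
    fun y hy hyK => by rw [hφ0 y hy hyK, zero_mul]

theorem integrableOn_sum_normalVelocityDensity [IsFiniteMeasureOnCompacts μ] {t : ℝ}
    (ht : t ∈ Set.Ioo (0 : ℝ) 1) : IntegrableOn
      (fun y => ∑ j, fderiv ℝ φ y (e j) * normalVelocityDensity e g u n j (t, y)) U μ :=
  integrableOn_of_compact h.isOpen hK hKU (h.continuousOn_sum_normalVelocityDensity hV hφ ht)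
    fun y hy hyK => Finset.sum_eq_zero fun j _ => by
      rw [fderiv_apply_eq_zero_of_notMem h.isOpen hK.isClosed hφ0 hy hyK, zero_mul]

/-- For a test function `φ`, the derivative in `t` of `-∫ φ H dA` is `-∫ dφ(W) dA`, where `W` is the
tangent vector field with `du(W) = ∂ₜn`. -/
theorem hasDerivAt_integral_meanCurvatureDensity [FiniteDimensional ℝ E] [μ.IsAddHaarMeasure]
    {t : ℝ} (ht : t ∈ Set.Ioo (0 : ℝ) 1) :
    HasDerivAt (fun t => ∫ y in U, φ y * meanCurvatureDensity e g u n (t, y) ∂μ)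
      (-∫ y in U, ∑ j, fderiv ℝ φ y (e j) * normalVelocityDensity e g u n j (t, y) ∂μ) t := by
  have hU := h.isOpen
  have hO : IsOpen (Set.Ioo (0 : ℝ) 1 ×ˢ U) := isOpen_Ioo.prod hU
  have hs : Set.Ioo (0 : ℝ) 1 ×ˢ U ⊆ Set.Icc 0 1 ×ˢ U :=
    Set.prod_mono Set.Ioo_subset_Icc_self subset_rfl
  have hD := h.contDiffOn_meanCurvatureDensity hV
  have hφc : ContinuousOn (fun z : ℝ × E => φ z.2) (Set.Ioo (0 : ℝ) 1 ×ˢ U) :=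
    hφ.continuousOn.comp continuousOn_snd fun z hz => hz.2
  have hφ1 : ∀ j, ∀ y ∈ U, y ∉ K → fderiv ℝ φ y (e j) = 0 := fun j y hy hyK =>
    fderiv_apply_eq_zero_of_notMem hU hK.isClosed hφ0 hy hyK (e j)
  have hw : ∀ j, ContDiffOn ℝ ∞ (fun y => normalVelocityDensity e g u n j (t, y)) U := fun j =>
    (h.contDiffOn_normalVelocityDensity hV j).comp (f := fun y : E => (t, y))
      (contDiff_prodMk_right _).contDiffOn fun y hy => ⟨ht, hy⟩
  have hder := hasDerivAt_integral_of_compact (μ := μ) isOpen_Ioo hU hK hKU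
    (h := fun z => φ z.2 * meanCurvatureDensity e g u n z)
    (h' := fun z => φ z.2 * fderiv ℝ (meanCurvatureDensity e g u n) z (1, 0))
    (hφc.mul (hD.mono hs).continuousOn)
    (hφc.mul (contDiffOn_fderiv_apply hO (hD.mono hs) _).continuousOn)
    (fun z hz hzK => by rw [hφ0 z.2 hz.2 hzK, zero_mul])
    (fun z hz hzK => by rw [hφ0 z.2 hz.2 hzK, zero_mul])
    (fun z hz => (hasDerivAt_time hU hD hz).const_mul (φ z.2)) ht
  -- Up to a divergence, `φ ∂ₜ(√(det g) gⁱʲ ⟪∂ᵢu, ∂ⱼn⟫)` is `-√(det g) dφ(W)`.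
  suffices heq : ∫ y in U, φ y * fderiv ℝ (meanCurvatureDensity e g u n) (t, y) (1, 0) ∂μ =
      -∫ y in U, ∑ j, fderiv ℝ φ y (e j) * normalVelocityDensity e g u n j (t, y) ∂μ from
    heq ▸ hder
  have hpt : ∀ y ∈ U, φ y * fderiv ℝ (meanCurvatureDensity e g u n) (t, y) (1, 0) =
      ∑ j, fderiv ℝ (fun y => φ y * normalVelocityDensity e g u n j (t, y)) y (e j) -
        ∑ j, fderiv ℝ φ y (e j) * normalVelocityDensity e g u n j (t, y) := fun y hy => by
    rw [h.fderiv_meanCurvatureDensity hV ⟨ht, hy⟩, Finset.mul_sum, ← Finset.sum_sub_distrib]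
    refine Finset.sum_congr rfl fun j _ => ?_
    have h1 : fderiv ℝ (fun y => normalVelocityDensity e g u n j (t, y)) y (e j) =
        fderiv ℝ (normalVelocityDensity e g u n j) (t, y) (0, e j) := by
      have h2 := (differentiableAt_of_contDiffOn hO (z := (t, y)) ⟨ht, hy⟩
        (h.contDiffOn_normalVelocityDensity hV j)).hasFDerivAt.comp y
        (hasFDerivAt_prodMk_right t y)
      exact congrArg (fun L : E →L[ℝ] ℝ => L (e j)) h2.fderiv
    rw [fderiv_fun_mul (differentiableAt_of_contDiffOn hU hy hφ)
      (differentiableAt_of_contDiffOn hU hy (hw j)), ← h1]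
    simp only [_root_.add_apply, _root_.smul_apply, smul_eq_mul]
    ring
  have hi1 : ∀ j, IntegrableOn
      (fun y => fderiv ℝ (fun y => φ y * normalVelocityDensity e g u n j (t, y)) y (e j)) U μ :=
    fun j => integrableOn_of_compact hU hK hKU
      (contDiffOn_fderiv_apply hU (hφ.mul (hw j)) (e j)).continuousOn fun y hy hyK => by
        rw [fderiv_fun_mul (differentiableAt_of_contDiffOn hU hy hφ)
          (differentiableAt_of_contDiffOn hU hy (hw j))]
        simp [hφ0 y hy hyK, hφ1 j y hy hyK]
  have hi2 := h.integrableOn_sum_normalVelocityDensity hV (μ := μ) hK hKU hφ hφ0 ht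
  rw [setIntegral_congr_fun hU.measurableSet hpt, integral_sub (integrable_finsetSum _ fun j _ =>
    hi1 j) hi2, integral_finsetSum _ fun j _ => hi1 j, Finset.sum_eq_zero, zero_sub]
  exact fun j _ => integral_fderiv_eq_zero_of_compact hU hK hKU (hφ.mul (hw j))
    (fun y hy hyK => by rw [hφ0 y hy hyK, zero_mul]) (e j)

end IsBendingInCoordinates

end ChartVariation

/-! ### Hypersurfaces in coordinates -/

section Coordinates

variable {m : ℕ} {S : Type*} [TopologicalSpace S] [ChartedSpace (EuclideanSpace ℝ (Fin m)) S]
  {W : Type*} [NormedAddCommGroup W] [NormedSpace ℝ W]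

/-- The standard basis vector `bᵢ` of the coordinate space. -/
def coordBasis (m : ℕ) (i : Fin m) : EuclideanSpace ℝ (Fin m) := EuclideanSpace.single i 1

/-- The differential at `x` of a map from `S` to a normed space. -/
def tangentDeriv (F : S → W) (x : S) : TangentSpace (𝓡 m) x →ₗ[ℝ] W :=
  (mfderiv (𝓡 m) 𝓘(ℝ, W) F x : TangentSpace (𝓡 m) x →L[ℝ] W).toLinearMap

variable {e : OpenPartialHomeomorph S (EuclideanSpace ℝ (Fin m))}
  (he : e.MDifferentiable (𝓡 m) (𝓡 m))
include he

theorem fderiv_comp_chart_symm {F : S → W} {y : EuclideanSpace ℝ (Fin m)} (hy : y ∈ e.target)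
    (hF : MDifferentiableAt (𝓡 m) 𝓘(ℝ, W) F (e.symm y)) (i : Fin m) :
    fderiv ℝ (fun z => F (e.symm z)) y (coordBasis m i) =
      tangentDeriv F (e.symm y) (coordVector e y i) := by
  have h1 := mfderiv_comp y hF (he.symm.mdifferentiableAt hy)
  rw [mfderiv_eq_fderiv] at h1
  exact congrArg (fun L : EuclideanSpace ℝ (Fin m) →L[ℝ] W => L (EuclideanSpace.single i 1)) h1

/-- The coordinate vectors of a chart, as a basis of the tangent space. -/
def coordVectorBasis {y : EuclideanSpace ℝ (Fin m)} (hy : y ∈ e.target) :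
    Module.Basis (Fin m) ℝ (TangentSpace (𝓡 m) (e.symm y)) :=
  (EuclideanSpace.basisFun (Fin m) ℝ).toBasis.map (he.symm.mfderiv hy).toLinearEquiv

theorem coordVectorBasis_apply {y : EuclideanSpace ℝ (Fin m)} (hy : y ∈ e.target) (i : Fin m) :
    coordVectorBasis he hy i = coordVector e y i := by
  change (he.symm.mfderiv hy) ((EuclideanSpace.basisFun (Fin m) ℝ).toBasis i) = _
  rw [OrthonormalBasis.coe_toBasis, EuclideanSpace.basisFun_apply]
  rfl

theorem gramMatrix_inducedMetric {f : S → EuclideanSpace ℝ (Fin (m + 1))}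
    {y : EuclideanSpace ℝ (Fin m)} (hy : y ∈ e.target)
    (hf : MDifferentiableAt (𝓡 m) 𝓘(ℝ, EuclideanSpace ℝ (Fin (m + 1))) f (e.symm y))
    (i j : Fin m) :
    gramMatrix (inducedMetric f) e y i j =
      inner ℝ (fderiv ℝ (fun z => f (e.symm z)) y (coordBasis m i))
        (fderiv ℝ (fun z => f (e.symm z)) y (coordBasis m j)) := by
  rw [fderiv_comp_chart_symm he hy hf, fderiv_comp_chart_symm he hy hf]
  rfl

theorem det_gramMatrix_pos {f : S → EuclideanSpace ℝ (Fin (m + 1))} (hf : IsImmersedHypersurface f)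
    {y : EuclideanSpace ℝ (Fin m)} (hy : y ∈ e.target) :
    0 < (gramMatrix (inducedMetric f) e y).det := by
  have h1 : LinearIndependent ℝ fun i => differential f (e.symm y) (coordVectorBasis he hy i) :=
    (coordVectorBasis he hy).linearIndependent.map' _ (LinearMap.ker_eq_bot.2 (hf.2 _))
  have h2 := (Matrix.posDef_gram_iff_linearIndependent.2 h1).det_pos
  have h3 : gramMatrix (inducedMetric f) e y =
      Matrix.gram ℝ fun i => differential f (e.symm y) (coordVectorBasis he hy i) := by
    ext i j
    rw [Matrix.gram_apply, coordVectorBasis_apply, coordVectorBasis_apply]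
    rfl
  rwa [h3]

/-- `√(det g) gⁱʲ ⟪∂ᵢf, ∂ⱼν⟫ = -√(det g) H`. -/
theorem sum_inverseMetricDensity_mul_eq_meanCurvature {f ν : S → EuclideanSpace ℝ (Fin (m + 1))}
    (hf : IsImmersedHypersurface f) (hν : IsUnitNormal f ν)
    {y : EuclideanSpace ℝ (Fin m)} (hy : y ∈ e.target)
    (hd : MDifferentiableAt (𝓡 m) 𝓘(ℝ, EuclideanSpace ℝ (Fin (m + 1))) ν (e.symm y)) :
    ∑ i, ∑ j, inverseMetricDensity (gramMatrix (inducedMetric f) e y) i j *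
      inner ℝ (fderiv ℝ (fun z => f (e.symm z)) y (coordBasis m i))
        (fderiv ℝ (fun z => ν (e.symm z)) y (coordBasis m j)) =
      -(√(gramMatrix (inducedMetric f) e y).det * meanCurvature f ν (e.symm y)) := by
  have hfd := (hf.1 (e.symm y)).mdifferentiableAt (by simp)
  set g := gramMatrix (inducedMetric f) e y with hg
  set X := coordVectorBasis he hy with hX
  set β := LinearMap.toMatrix X X (shapeOperator f ν (e.symm y)) with hβ
  have hgX : ∀ i j, inner ℝ (differential f (e.symm y) (X i)) (differential f (e.symm y) (X j)) =
      g i j := fun i j => by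
    rw [hX, coordVectorBasis_apply, coordVectorBasis_apply]
    rfl
  have hsym : ∀ i j, g i j = g j i := fun i j => by
    rw [← hgX, ← hgX, real_inner_comm]
  have h1 : ∀ i j, inner ℝ (fderiv ℝ (fun z => f (e.symm z)) y (coordBasis m i))
      (fderiv ℝ (fun z => ν (e.symm z)) y (coordBasis m j)) = -∑ k, β k j * g i k := fun i j => by
    have h2 : -differential ν (e.symm y) (X j) =
        ∑ k, β k j • differential f (e.symm y) (X k) := by
      rw [← differential_shapeOperator hf hν _ hd, ← X.sum_repr (shapeOperator f ν _ (X j)),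
        map_sum]
      exact Finset.sum_congr rfl fun k _ => by rw [map_smul, hβ, LinearMap.toMatrix_apply]
    rw [fderiv_comp_chart_symm he hy hfd, fderiv_comp_chart_symm he hy hd,
      ← coordVectorBasis_apply he hy, ← coordVectorBasis_apply he hy]
    change inner ℝ (differential f (e.symm y) (X i)) (differential ν (e.symm y) (X j)) = _
    rw [← neg_neg (differential ν (e.symm y) (X j)), h2, inner_neg_right, inner_sum]
    simp only [real_inner_smul_right, hgX]
  have h3 : meanCurvature f ν (e.symm y) = ∑ j, β j j := by
    rw [meanCurvature, LinearMap.trace_eq_matrix_trace ℝ X]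
    rfl
  simp only [h1, h3, mul_neg, Finset.sum_neg_distrib, Finset.mul_sum, neg_inj]
  have hdet : g.det ≠ 0 := (det_gramMatrix_pos he hf hy).ne'
  calc ∑ i, ∑ j, ∑ k, inverseMetricDensity g i j * (β k j * g i k)
      = ∑ j, ∑ k, β k j * ∑ i, inverseMetricDensity g j i * g i k := by
        rw [Finset.sum_comm]
        refine Finset.sum_congr rfl fun j _ => ?_
        rw [Finset.sum_comm]
        refine Finset.sum_congr rfl fun k _ => ?_
        rw [Finset.mul_sum]
        refine Finset.sum_congr rfl fun i _ => ?_
        rw [inverseMetricDensity_symm hsym]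
        ring
    _ = ∑ j, √g.det * β j j := by
        refine Finset.sum_congr rfl fun j _ => ?_
        simp only [sum_inverseMetricDensity_mul hdet, mul_ite, mul_zero]
        rw [Finset.sum_ite_eq Finset.univ j, if_pos (Finset.mem_univ j), mul_comm]

/-- For `w` tangent to the hypersurface, `√(det g) gⁱʲ ⟪∂ᵢf, w⟫ ∂ⱼρ = √(det g) dρ(df⁻¹ w)`. -/
theorem sum_fderiv_mul_inverseMetricDensity {f : S → EuclideanSpace ℝ (Fin (m + 1))}
    (hf : IsImmersedHypersurface f) {ρ : S → ℝ} {y : EuclideanSpace ℝ (Fin m)} (hy : y ∈ e.target)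
    (hρ : MDifferentiableAt (𝓡 m) 𝓘(ℝ, ℝ) ρ (e.symm y)) {n w : EuclideanSpace ℝ (Fin (m + 1))}
    (hn : n ≠ 0) (hfn : ∀ X, inner ℝ (differential f (e.symm y) X) n = 0)
    (hw : inner ℝ w n = 0) :
    ∑ j, fderiv ℝ (fun z => ρ (e.symm z)) y (coordBasis m j) *
      ∑ i, inverseMetricDensity (gramMatrix (inducedMetric f) e y) i j *
        inner ℝ (fderiv ℝ (fun z => f (e.symm z)) y (coordBasis m i)) w =
      √(gramMatrix (inducedMetric f) e y).det *
        tangentDeriv ρ (e.symm y)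
          ((differential f (e.symm y)).leftInverse w) := by
  have hfd := (hf.1 (e.symm y)).mdifferentiableAt (by simp)
  set g := gramMatrix (inducedMetric f) e y with hg
  set X := coordVectorBasis he hy with hX
  have hgX : ∀ i j, inner ℝ (differential f (e.symm y) (X i)) (differential f (e.symm y) (X j)) =
      g i j := fun i j => by
    rw [hX, coordVectorBasis_apply, coordVectorBasis_apply]
    rfl
  have hsym : ∀ i j, g i j = g j i := fun i j => by
    rw [← hgX, ← hgX, real_inner_comm]
  have h1 : ∀ i, fderiv ℝ (fun z => f (e.symm z)) y (coordBasis m i) =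
      differential f (e.symm y) (X i) := fun i => by
    rw [fderiv_comp_chart_symm he hy hfd, ← coordVectorBasis_apply he hy]
    rfl
  have h2 := eq_sum_inv_gram_smul (by simp) hgX (det_gramMatrix_pos he hf hy).ne' hn
    (fun i => hfn (X i)) hw
  have h3 : (differential f (e.symm y)).leftInverse w =
      ∑ k, (∑ l, g⁻¹ k l * inner ℝ (differential f (e.symm y) (X l)) w) • X k := by
    have h4 : w = differential f (e.symm y)
        (∑ k, (∑ l, g⁻¹ k l * inner ℝ (differential f (e.symm y) (X l)) w) • X k) := by
      rw [map_sum (differential f (e.symm y))]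
      simp only [map_smul]
      exact h2
    conv_lhs => rw [h4]
    exact LinearMap.leftInverse_apply_of_inj (LinearMap.ker_eq_bot.2 (hf.2 _)) _
  rw [h3, map_sum (tangentDeriv ρ (e.symm y)), Finset.mul_sum]
  refine Finset.sum_congr rfl fun j _ => ?_
  have h5 : ∑ i, inverseMetricDensity g i j *
      inner ℝ (fderiv ℝ (fun z => f (e.symm z)) y (coordBasis m i)) w =
      √g.det * ∑ l, g⁻¹ j l * inner ℝ (differential f (e.symm y) (X l)) w := by
    rw [Finset.mul_sum]
    refine Finset.sum_congr rfl fun i _ => ?_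
    rw [inverseMetricDensity_symm hsym, h1, inverseMetricDensity, Matrix.smul_apply, smul_eq_mul,
      mul_assoc]
  rw [h5, map_smul, fderiv_comp_chart_symm he hy hρ, ← coordVectorBasis_apply he hy, smul_eq_mul]
  ring

end Coordinates

section Deformation

variable {m : ℕ} {S : Type*} [TopologicalSpace S] [ChartedSpace (EuclideanSpace ℝ (Fin m)) S]

/-- A family of functions on `S`, as a function of the time and of the coordinates of a chart. -/
def inChart {V : Type*} (e : OpenPartialHomeomorph S (EuclideanSpace ℝ (Fin m))) (F : ℝ → S → V)
    (z : ℝ × EuclideanSpace ℝ (Fin m)) : V :=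
  F z.1 (e.symm z.2)

variable [IsManifold (𝓡 m) ∞ S] {f ν : ℝ → S → EuclideanSpace ℝ (Fin (m + 1))}
  (hf : IsIsometricDeformation f) (hν : IsUnitNormalFamily f ν) (p : S)

theorem mdifferentiable_chartAt (p : S) :
    (chartAt (EuclideanSpace ℝ (Fin m)) p).MDifferentiable (𝓡 m) (𝓡 m) :=
  have : IsManifold (𝓡 m) 1 S := IsManifold.of_le (n := ∞) (by simp)
  mdifferentiable_chart p

include hf hν

theorem isBendingInCoordinates :
    IsBendingInCoordinates (chartAt (EuclideanSpace ℝ (Fin m)) p).target (coordBasis m)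
      (gramMatrix (inducedMetric (f 0)) (chartAt (EuclideanSpace ℝ (Fin m)) p))
      (inChart (chartAt (EuclideanSpace ℝ (Fin m)) p) f)
      (inChart (chartAt (EuclideanSpace ℝ (Fin m)) p) ν) := by
  set e := chartAt (EuclideanSpace ℝ (Fin m)) p with hedef
  have he : e.MDifferentiable (𝓡 m) (𝓡 m) := mdifferentiable_chartAt p
  have hfd : ∀ t ∈ Set.Icc (0 : ℝ) 1, ∀ x,
      MDifferentiableAt (𝓡 m) 𝓘(ℝ, EuclideanSpace ℝ (Fin (m + 1))) (f t) x := fun t ht x =>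
    ((hf.immersed t ht).1 x).mdifferentiableAt (by simp)
  refine ⟨e.open_target, ?_, ?_, ?_, ?_, ?_, ?_⟩
  · have h1 : ContMDiffOn (𝓘(ℝ, ℝ).prod (𝓡 m)) (𝓘(ℝ, ℝ).prod (𝓡 m)) ∞
        (Prod.map id e.symm) (Set.Icc (0 : ℝ) 1 ×ˢ e.target) :=
      contMDiffOn_id.prodMap contMDiffOn_chart_symm
    have h2 := hf.smooth.comp h1 fun z hz => ⟨hz.1, trivial⟩
    rw [← modelWithCornersSelf_prod, chartedSpaceSelf_prod] at h2
    exact contMDiffOn_iff_contDiffOn.1 h2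
  · exact hν.continuous.comp (f := Prod.map id e.symm)
      (continuousOn_id.prodMap e.continuousOn_symm) fun z hz => ⟨hz.1, trivial⟩
  · intro z hz i j
    rw [← hf.isometric z.1 hz.1, gramMatrix_inducedMetric he hz.2 (hfd z.1 hz.1 _)]
    rfl
  · exact fun y hy => det_gramMatrix_pos he (hf.immersed 0 ⟨le_rfl, zero_le_one⟩) hy
  · intro z hz i
    have h1 : spatialDeriv (coordBasis m i) (inChart e f) z = _ :=
      fderiv_comp_chart_symm he hz.2 (hfd z.1 hz.1 _) i
    rw [h1]
    exact ((hν.normal z.1 hz.1) (e.symm z.2)).2 _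
  · exact fun z hz => ((hν.normal z.1 hz.1) (e.symm z.2)).1

theorem mdifferentiableAt_normal {t : ℝ} (ht : t ∈ Set.Icc (0 : ℝ) 1) (x : S) :
    MDifferentiableAt (𝓡 m) 𝓘(ℝ, EuclideanSpace ℝ (Fin (m + 1))) (ν t) x := by
  set e := chartAt (EuclideanSpace ℝ (Fin m)) x with hedef
  have hx : x ∈ e.source := mem_chart_source _ x
  have h1 : ContDiffOn ℝ ∞ (fun y => inChart e ν (t, y)) e.target :=
    ((isBendingInCoordinates hf hν x).contDiffOn_normal (by simp)).comp
      (f := fun y => (t, y)) (contDiff_prodMk_right _).contDiffOn fun y hy => ⟨ht, hy⟩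
  have h2 := (differentiableAt_of_contDiffOn e.open_target (e.map_source hx) h1).mdifferentiableAt
  have h3 := h2.comp x ((mdifferentiable_chartAt x).mdifferentiableAt hx)
  refine h3.congr_of_eventuallyEq ?_
  filter_upwards [e.open_source.mem_nhds hx] with y hy
  simp [inChart, e.left_inv hy]

theorem meanCurvatureDensity_inChart {t : ℝ} (ht : t ∈ Set.Icc (0 : ℝ) 1)
    {y : EuclideanSpace ℝ (Fin m)} (hy : y ∈ (chartAt (EuclideanSpace ℝ (Fin m)) p).target) :
    meanCurvatureDensity (coordBasis m)
      (gramMatrix (inducedMetric (f 0)) (chartAt (EuclideanSpace ℝ (Fin m)) p))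
      (inChart (chartAt (EuclideanSpace ℝ (Fin m)) p) f)
      (inChart (chartAt (EuclideanSpace ℝ (Fin m)) p) ν) (t, y) =
    -(√(gramMatrix (inducedMetric (f 0)) (chartAt (EuclideanSpace ℝ (Fin m)) p) y).det *
      meanCurvature (f t) (ν t) ((chartAt (EuclideanSpace ℝ (Fin m)) p).symm y)) := by
  rw [← hf.isometric t ht, ← sum_inverseMetricDensity_mul_eq_meanCurvature
    (mdifferentiable_chartAt p) (hf.immersed t ht) (hν.normal t ht) hy
    (mdifferentiableAt_normal hf hν ht _)]
  rfl

/-- The derivative of `ρ` along the tangent vector field `W` with `df(W) = ∂ₜν`. -/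
def derivAlongNormalVelocity (f ν : ℝ → S → EuclideanSpace ℝ (Fin (m + 1))) (ρ : S → ℝ) (t : ℝ)
    (x : S) : ℝ :=
  tangentDeriv ρ x ((differential (f t) x).leftInverse (deriv (fun s => ν s x) t))

theorem sum_fderiv_mul_normalVelocityDensity_inChart {t : ℝ} (ht : t ∈ Set.Ioo (0 : ℝ) 1)
    {y : EuclideanSpace ℝ (Fin m)} (hy : y ∈ (chartAt (EuclideanSpace ℝ (Fin m)) p).target)
    {ρ : S → ℝ} (hρ : MDifferentiable (𝓡 m) 𝓘(ℝ, ℝ) ρ) :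
    ∑ j, fderiv ℝ (fun z => ρ ((chartAt (EuclideanSpace ℝ (Fin m)) p).symm z)) y (coordBasis m j) *
      normalVelocityDensity (coordBasis m)
        (gramMatrix (inducedMetric (f 0)) (chartAt (EuclideanSpace ℝ (Fin m)) p))
        (inChart (chartAt (EuclideanSpace ℝ (Fin m)) p) f)
        (inChart (chartAt (EuclideanSpace ℝ (Fin m)) p) ν) j (t, y) =
    √(gramMatrix (inducedMetric (f 0)) (chartAt (EuclideanSpace ℝ (Fin m)) p) y).det *
      derivAlongNormalVelocity f ν ρ t ((chartAt (EuclideanSpace ℝ (Fin m)) p).symm y) := by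
  have ht' := Set.Ioo_subset_Icc_self ht
  have hB := isBendingInCoordinates hf hν p
  have hn := hB.contDiffOn_normal (by simp)
  set e := chartAt (EuclideanSpace ℝ (Fin m)) p with hedef
  have hz : (t, y) ∈ Set.Ioo (0 : ℝ) 1 ×ˢ e.target := ⟨ht, hy⟩
  have hder : deriv (fun s => ν s (e.symm y)) t = fderiv ℝ (inChart e ν) (t, y) (1, 0) :=
    (hasDerivAt_time e.open_target hn hz).deriv
  have hnorm := ((hν.normal t ht') (e.symm y)).1
  have horth : inner ℝ (fderiv ℝ (inChart e ν) (t, y) (1, 0)) (ν t (e.symm y)) = 0 := by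
    have hnd := (hn.contDiffAt (slab_mem_nhds e.open_target hz)).differentiableAt (by simp)
    have h1 := fderiv_inner_of_eventuallyEq hnd hnd (k := fun _ => 1) (by
      filter_upwards [slab_mem_nhds e.open_target hz] with x hx
      rw [real_inner_self_eq_norm_sq, hB.norm_eq_one x hx, one_pow]) (1, 0)
    rw [real_inner_comm] at h1
    simp only [fderiv_fun_const, Pi.zero_apply, _root_.zero_apply] at h1
    change inner ℝ _ (inChart e ν (t, y)) = 0
    rw [real_inner_comm]
    linarith
  have key := sum_fderiv_mul_inverseMetricDensity (mdifferentiable_chartAt p) (hf.immersed t ht') hy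
    (hρ _) (n := ν t (e.symm y)) (fun h0 => by simp [h0] at hnorm)
    ((hν.normal t ht') (e.symm y)).2 horth
  rw [hf.isometric t ht'] at key
  rw [derivAlongNormalVelocity, hder, ← key]
  rfl

end Deformation

/-! ### The Riemannian volume measure -/

section Volume

open MeasureTheory

variable {m : ℕ} {S : Type*} [TopologicalSpace S] [ChartedSpace (EuclideanSpace ℝ (Fin m)) S]

omit [ChartedSpace (EuclideanSpace ℝ (Fin m)) S] in
theorem measurableSet_target_inter_preimage [MeasurableSpace S] [BorelSpace S]
    (e : OpenPartialHomeomorph S (EuclideanSpace ℝ (Fin m))) {s : Set S} (hs : MeasurableSet s) :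
    MeasurableSet (e.target ∩ e.symm ⁻¹' s) := by
  have h1 := (continuousOn_iff_continuous_domRestrict.1 e.continuousOn_symm).measurable hs
  have h2 := e.open_target.measurableSet.subtype_image h1
  rwa [show e.target.domRestrict e.symm ⁻¹' s = Subtype.val ⁻¹' (e.symm ⁻¹' s) from rfl,
    Subtype.image_preimage_coe] at h2

section Gram

variable {e e' : OpenPartialHomeomorph S (EuclideanSpace ℝ (Fin m))}
  (he : e.MDifferentiable (𝓡 m) (𝓡 m)) (he' : e'.MDifferentiable (𝓡 m) (𝓡 m))
  {f : S → EuclideanSpace ℝ (Fin (m + 1))} (hf : IsImmersedHypersurface f)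
include he

theorem differentiableAt_transition (he' : e'.MDifferentiable (𝓡 m) (𝓡 m))
    {y : EuclideanSpace ℝ (Fin m)} (hy : y ∈ e.target)
    (hy' : e.symm y ∈ e'.source) : DifferentiableAt ℝ (fun z => e' (e.symm z)) y :=
  mdifferentiableAt_iff_differentiableAt.1
    ((he'.mdifferentiableAt hy').comp y (he.symm.mdifferentiableAt hy))

include hf

theorem continuousOn_det_gramMatrix [IsManifold (𝓡 m) ∞ S] (hee : e ∈ atlas _ S) :
    ContinuousOn (fun y => (gramMatrix (inducedMetric f) e y).det) e.target := by
  have h1 : ContDiffOn ℝ ∞ (fun y => f (e.symm y)) e.target :=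
    contMDiffOn_iff_contDiffOn.1 (hf.1.comp_contMDiffOn
      (contMDiffOn_symm_of_mem_maximalAtlas (IsManifold.subset_maximalAtlas hee)))
  refine (contDiffOn_det (n := ∞) fun i j => ?_).continuousOn
  refine ((contDiffOn_fderiv_apply e.open_target h1 (coordBasis m i)).inner ℝ
    (contDiffOn_fderiv_apply e.open_target h1 (coordBasis m j))).congr fun y hy => ?_
  exact gramMatrix_inducedMetric he hy ((hf.1 _).mdifferentiableAt (by simp)) i j

include he'

/-- The transformation rule of `√(det g)` under a change of coordinates. -/
theorem sqrt_det_gramMatrix_transition {y : EuclideanSpace ℝ (Fin m)} (hy : y ∈ e.target)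
    (hy' : e.symm y ∈ e'.source) :
    √(gramMatrix (inducedMetric f) e y).det =
      |(fderiv ℝ (fun z => e' (e.symm z)) y).det| *
        √(gramMatrix (inducedMetric f) e' (e' (e.symm y))).det := by
  set τ : EuclideanSpace ℝ (Fin m) → EuclideanSpace ℝ (Fin m) := fun z => e' (e.symm z) with hτ
  have hfd : ∀ x, MDifferentiableAt (𝓡 m) 𝓘(ℝ, EuclideanSpace ℝ (Fin (m + 1))) f x := fun x =>
    (hf.1 x).mdifferentiableAt (by simp)
  have hτd : DifferentiableAt ℝ τ y := differentiableAt_transition he he' hy hy'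
  have hτy : τ y ∈ e'.target := e'.map_source hy'
  set B := (EuclideanSpace.basisFun (Fin m) ℝ).toBasis with hB
  have hBi : ∀ i, B i = coordBasis m i := fun i => by
    rw [hB, OrthonormalBasis.coe_toBasis, EuclideanSpace.basisFun_apply]
    rfl
  set J := LinearMap.toMatrix B B (fderiv ℝ τ y : EuclideanSpace ℝ (Fin m) →ₗ[ℝ] _) with hJ
  have hJd : J.det = (fderiv ℝ τ y).det := LinearMap.det_toMatrix B _
  have hfd' : DifferentiableAt ℝ (fun z => f (e'.symm z)) (τ y) :=
    mdifferentiableAt_iff_differentiableAt.1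
      ((hfd _).comp (τ y) (he'.symm.mdifferentiableAt hτy))
  have h1 : ∀ i, fderiv ℝ (fun z => f (e.symm z)) y (coordBasis m i) =
      ∑ k, J k i • fderiv ℝ (fun z => f (e'.symm z)) (τ y) (coordBasis m k) := fun i => by
    have h2 : (fun z => f (e.symm z)) =ᶠ[nhds y] (fun z => f (e'.symm z)) ∘ τ := by
      filter_upwards [(e.isOpen_inter_preimage_symm e'.open_source).mem_nhds ⟨hy, hy'⟩] with z hz
      simp only [Function.comp_apply, hτ, e'.left_inv hz.2]
    have h3 : fderiv ℝ τ y (coordBasis m i) = ∑ k, J k i • coordBasis m k := by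
      rw [← B.sum_repr (fderiv ℝ τ y (coordBasis m i))]
      exact Finset.sum_congr rfl fun k _ => by rw [hJ, LinearMap.toMatrix_apply, hBi, hBi]; rfl
    rw [h2.fderiv_eq, fderiv_comp y hfd' hτd, ContinuousLinearMap.comp_apply, h3, map_sum]
    simp only [map_smul]
  have h4 : gramMatrix (inducedMetric f) e y =
      J.transpose * gramMatrix (inducedMetric f) e' (τ y) * J := by
    ext i j
    rw [gramMatrix_inducedMetric he hy (hfd _), h1, h1, Matrix.mul_apply]
    simp only [Matrix.mul_apply, Matrix.transpose_apply, sum_inner, inner_sum,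
      real_inner_smul_left, real_inner_smul_right, Finset.sum_mul,
      gramMatrix_inducedMetric he' hτy (hfd _)]
    refine Finset.sum_congr rfl fun k _ => Finset.sum_congr rfl fun l _ => ?_
    ring
  rw [h4, Matrix.det_mul, Matrix.det_mul, Matrix.det_transpose, hJd,
    show ∀ a b : ℝ, a * b * a = a ^ 2 * b from fun a b => by ring,
    Real.sqrt_mul (sq_nonneg _), Real.sqrt_sq_eq_abs]

end Gram

variable [MeasurableSpace S] [BorelSpace S]

theorem chartVolume_apply
    (g : ∀ x : S, TangentSpace (𝓡 m) x →ₗ[ℝ] TangentSpace (𝓡 m) x →ₗ[ℝ] ℝ)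
    (e : OpenPartialHomeomorph S (EuclideanSpace ℝ (Fin m))) {s : Set S} (hs : MeasurableSet s) :
    chartVolume g e s =
      ∫⁻ y in e.target ∩ e.symm ⁻¹' s, ENNReal.ofReal √(gramMatrix g e y).det := by
  have h1 : AEMeasurable e.symm ((volume.restrict e.target).withDensity
      fun y => ENNReal.ofReal √(gramMatrix g e y).det) :=
    (e.continuousOn_symm.aemeasurable e.open_target.measurableSet).mono_ac
      (withDensity_absolutelyContinuous _ _)
  rw [chartVolume, Measure.map_apply_of_aemeasurable h1 hs, withDensity_apply',
    Measure.restrict_restrict' e.open_target.measurableSet, Set.inter_comm]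

theorem chartVolume_restrict_source
    (g : ∀ x : S, TangentSpace (𝓡 m) x →ₗ[ℝ] TangentSpace (𝓡 m) x →ₗ[ℝ] ℝ)
    (e : OpenPartialHomeomorph S (EuclideanSpace ℝ (Fin m))) :
    (chartVolume g e).restrict e.source = chartVolume g e := by
  refine Measure.ext fun s hs => ?_
  rw [Measure.restrict_apply hs, chartVolume_apply g e hs,
    chartVolume_apply g e (hs.inter e.open_source.measurableSet)]
  congr 2
  ext y
  exact ⟨fun h => ⟨h.1, h.2.1⟩, fun h => ⟨h.1, h.2, e.map_target h.1⟩⟩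

/-- The volume measures of two charts agree where both charts are defined. -/
theorem chartVolume_apply_eq {f : S → EuclideanSpace ℝ (Fin (m + 1))}
    (hf : IsImmersedHypersurface f) {e e' : OpenPartialHomeomorph S (EuclideanSpace ℝ (Fin m))}
    (he : e.MDifferentiable (𝓡 m) (𝓡 m)) (he' : e'.MDifferentiable (𝓡 m) (𝓡 m))
    {s : Set S} (hs : MeasurableSet s) (hse : s ⊆ e.source) (hse' : s ⊆ e'.source) :
    chartVolume (inducedMetric f) e s = chartVolume (inducedMetric f) e' s := by
  rw [chartVolume_apply _ e hs, chartVolume_apply _ e' hs]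
  have himg : e'.target ∩ e'.symm ⁻¹' s =
      (fun z => e' (e.symm z)) '' (e.target ∩ e.symm ⁻¹' s) := by
    ext z
    constructor
    · rintro ⟨hz, hzs⟩
      refine ⟨e (e'.symm z), ⟨e.map_source (hse hzs), ?_⟩, ?_⟩
      · rw [Set.mem_preimage, e.left_inv (hse hzs)]
        exact hzs
      · simp only [e.left_inv (hse hzs), e'.right_inv hz]
    · rintro ⟨y, ⟨hy, hys⟩, rfl⟩
      refine ⟨e'.map_source (hse' hys), ?_⟩
      rw [Set.mem_preimage, e'.left_inv (hse' hys)]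
      exact hys
  have hinj : Set.InjOn (fun z => e' (e.symm z)) (e.target ∩ e.symm ⁻¹' s) :=
    fun y hy z hz hyz => e.symm.injOn hy.1 hz.1 (e'.injOn (hse' hy.2) (hse' hz.2) hyz)
  have hms := measurableSet_target_inter_preimage e hs
  rw [himg, lintegral_image_eq_lintegral_abs_det_fderiv_mul volume hms (fun y hy =>
    (differentiableAt_transition he he' hy.1 (hse' hy.2)).hasFDerivAt.hasFDerivWithinAt) hinj]
  refine setLIntegral_congr_fun hms fun y hy => ?_
  beta_reduce
  rw [sqrt_det_gramMatrix_transition he he' hf hy.1 (hse' hy.2),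
    ENNReal.ofReal_mul (abs_nonneg _)]

variable [IsManifold (𝓡 m) ∞ S]

section Integrals

variable {f : S → EuclideanSpace ℝ (Fin (m + 1))} (hf : IsImmersedHypersurface f) (p : S)
  {F : S → ℝ} (hF : ContinuousOn F (chartAt (EuclideanSpace ℝ (Fin m)) p).source)

omit [IsManifold (𝓡 m) ∞ S] in
theorem aestronglyMeasurable_chartVolume
    (g : ∀ x : S, TangentSpace (𝓡 m) x →ₗ[ℝ] TangentSpace (𝓡 m) x →ₗ[ℝ] ℝ)
    (hF : ContinuousOn F (chartAt (EuclideanSpace ℝ (Fin m)) p).source) :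
    AEStronglyMeasurable F (chartVolume g (chartAt (EuclideanSpace ℝ (Fin m)) p)) := by
  rw [← chartVolume_restrict_source]
  exact hF.aestronglyMeasurable (chartAt _ p).open_source.measurableSet

include hf

omit [MeasurableSpace S] [BorelSpace S] in
theorem aemeasurable_ofReal_sqrt_det_gramMatrix :
    AEMeasurable (fun y => ENNReal.ofReal
      √(gramMatrix (inducedMetric f) (chartAt (EuclideanSpace ℝ (Fin m)) p) y).det)
      (volume.restrict (chartAt (EuclideanSpace ℝ (Fin m)) p).target) :=
  (((continuousOn_det_gramMatrix (mdifferentiable_chartAt p) hf (chart_mem_atlas _ p)).sqrt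
    ).aemeasurable (chartAt _ p).open_target.measurableSet).ennreal_ofReal

include hF

theorem integrable_chartVolume_iff :
    Integrable F (chartVolume (inducedMetric f) (chartAt (EuclideanSpace ℝ (Fin m)) p)) ↔
      IntegrableOn (fun y =>
        √(gramMatrix (inducedMetric f) (chartAt (EuclideanSpace ℝ (Fin m)) p) y).det *
          F ((chartAt (EuclideanSpace ℝ (Fin m)) p).symm y))
        (chartAt (EuclideanSpace ℝ (Fin m)) p).target := by
  have hm := aestronglyMeasurable_chartVolume p (inducedMetric f) hF
  set e := chartAt (EuclideanSpace ℝ (Fin m)) p with hedef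
  have h1 : AEMeasurable e.symm ((volume.restrict e.target).withDensity
      fun y => ENNReal.ofReal √(gramMatrix (inducedMetric f) e y).det) :=
    (e.continuousOn_symm.aemeasurable e.open_target.measurableSet).mono_ac
      (withDensity_absolutelyContinuous _ _)
  rw [chartVolume] at hm ⊢
  rw [integrable_map_measure hm h1, integrable_withDensity_iff_integrable_smul₀'
    (aemeasurable_ofReal_sqrt_det_gramMatrix hf p)
    (Filter.Eventually.of_forall fun _ => ENNReal.ofReal_lt_top)]
  simp only [ENNReal.toReal_ofReal (Real.sqrt_nonneg _), smul_eq_mul, Function.comp_apply]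
  rfl

theorem integral_chartVolume :
    ∫ x, F x ∂(chartVolume (inducedMetric f) (chartAt (EuclideanSpace ℝ (Fin m)) p)) =
      ∫ y in (chartAt (EuclideanSpace ℝ (Fin m)) p).target,
        √(gramMatrix (inducedMetric f) (chartAt (EuclideanSpace ℝ (Fin m)) p) y).det *
          F ((chartAt (EuclideanSpace ℝ (Fin m)) p).symm y) := by
  have hm := aestronglyMeasurable_chartVolume p (inducedMetric f) hF
  set e := chartAt (EuclideanSpace ℝ (Fin m)) p with hedef
  have h1 : AEMeasurable e.symm ((volume.restrict e.target).withDensity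
      fun y => ENNReal.ofReal √(gramMatrix (inducedMetric f) e y).det) :=
    (e.continuousOn_symm.aemeasurable e.open_target.measurableSet).mono_ac
      (withDensity_absolutelyContinuous _ _)
  rw [chartVolume] at hm ⊢
  rw [integral_map h1 hm, integral_withDensity_eq_integral_toReal_smul₀
    (aemeasurable_ofReal_sqrt_det_gramMatrix hf p)
    (Filter.Eventually.of_forall fun _ => ENNReal.ofReal_lt_top)]
  simp only [ENNReal.toReal_ofReal (Real.sqrt_nonneg _), smul_eq_mul]
  rfl

end Integrals

section Partition

variable [CompactSpace S] [T2Space S]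

omit [MeasurableSpace S] [BorelSpace S] in
theorem finite_support_chartPartition :
    {p | (Function.support (chartPartition m S p)).Nonempty}.Finite :=
  (chartPartition m S).locallyFinite.finite_nonempty_of_compact

/-- The finitely many indices at which the partition of unity does not vanish identically. -/
def chartPartitionIndices (m : ℕ) (S : Type*) [TopologicalSpace S]
    [ChartedSpace (EuclideanSpace ℝ (Fin m)) S] [IsManifold (𝓡 m) ∞ S] [CompactSpace S]
    [T2Space S] : Finset S :=
  (finite_support_chartPartition (m := m) (S := S)).toFinset

omit [MeasurableSpace S] [BorelSpace S] in
theorem chartPartition_eq_zero {p : S} (hp : p ∉ chartPartitionIndices m S) (x : S) :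
    chartPartition m S p x = 0 := by
  by_contra hx
  exact hp ((finite_support_chartPartition (m := m) (S := S)).mem_toFinset.2 ⟨x, hx⟩)

omit [MeasurableSpace S] [BorelSpace S] in
theorem sum_chartPartition (x : S) :
    ∑ p ∈ chartPartitionIndices m S, chartPartition m S p x = 1 := by
  rw [← finsum_eq_sum_of_support_subset]
  · exact (chartPartition m S).sum_eq_one (Set.mem_univ x)
  · intro p hp
    by_contra hp'
    exact hp (chartPartition_eq_zero hp' x)

omit [MeasurableSpace S] [BorelSpace S] in
theorem mem_source_of_chartPartition_ne_zero {p x : S} (h : chartPartition m S p x ≠ 0) :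
    x ∈ (chartAt (EuclideanSpace ℝ (Fin m)) p).source :=
  chartPartition_isSubordinate m S p (subset_tsupport _ h)

omit [BorelSpace S] in
theorem volumeMeasure_eq_sum
    (g : ∀ x : S, TangentSpace (𝓡 m) x →ₗ[ℝ] TangentSpace (𝓡 m) x →ₗ[ℝ] ℝ) :
    volumeMeasure g = ∑ p ∈ chartPartitionIndices m S,
      (chartVolume g (chartAt (EuclideanSpace ℝ (Fin m)) p)).withDensity
        fun x => ENNReal.ofReal (chartPartition m S p x) := by
  refine Measure.ext fun s hs => ?_
  rw [volumeMeasure, Measure.sum_apply _ hs, Measure.finsetSum_apply, tsum_eq_sum]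
  intro p hp
  simp [chartPartition_eq_zero hp]

theorem measurable_chartPartition (p : S) : Measurable fun x =>
    ENNReal.ofReal (chartPartition m S p x) :=
  ((chartPartition m S p).contMDiff.continuous.measurable).ennreal_ofReal

/-- In the domain of any chart, the volume measure is the one computed in that chart. -/
theorem volumeMeasure_restrict_source {f : S → EuclideanSpace ℝ (Fin (m + 1))}
    (hf : IsImmersedHypersurface f) (q : S) :
    (volumeMeasure (inducedMetric f)).restrict (chartAt (EuclideanSpace ℝ (Fin m)) q).source =
      chartVolume (inducedMetric f) (chartAt (EuclideanSpace ℝ (Fin m)) q) := by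
  refine Measure.ext fun s hs => ?_
  set c : S → OpenPartialHomeomorph S (EuclideanSpace ℝ (Fin m)) := fun p => chartAt _ p with hc
  have hsrc : ∀ p, MeasurableSet (c p).source := fun p => (c p).open_source.measurableSet
  have hsq := hs.inter (hsrc q)
  have hcoincide : ∀ p,
      (chartVolume (inducedMetric f) (c p)).restrict ((c q).source ∩ (c p).source) =
      (chartVolume (inducedMetric f) (c q)).restrict ((c q).source ∩ (c p).source) := fun p => by
    refine Measure.ext fun r hr => ?_
    rw [Measure.restrict_apply hr, Measure.restrict_apply hr]
    exact chartVolume_apply_eq hf (mdifferentiable_chartAt p) (mdifferentiable_chartAt q)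
      (hr.inter ((hsrc q).inter (hsrc p))) (fun x hx => hx.2.2) fun x hx => hx.2.1
  -- Off the domain of the chart at `p` the weight `ρₚ` vanishes.
  have hterm : ∀ p, ∫⁻ x in s ∩ (c q).source, ENNReal.ofReal (chartPartition m S p x)
      ∂(chartVolume (inducedMetric f) (c p)) =
      ∫⁻ x in s ∩ (c q).source, ENNReal.ofReal (chartPartition m S p x)
        ∂(chartVolume (inducedMetric f) (c q)) := fun p => by
    have hind : ∀ μ : Measure S, ∫⁻ x in s ∩ (c q).source,
        ENNReal.ofReal (chartPartition m S p x) ∂μ =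
        ∫⁻ x in s, ENNReal.ofReal (chartPartition m S p x)
          ∂(μ.restrict ((c q).source ∩ (c p).source)) := fun μ => by
      rw [← setLIntegral_eq_of_support_subset (s := (c p).source) (fun x hx =>
        mem_source_of_chartPartition_ne_zero fun h0 => hx (by rw [h0, ENNReal.ofReal_zero])),
        Measure.restrict_restrict (hsrc p), Measure.restrict_restrict hs, Set.inter_comm,
        Set.inter_assoc]
    rw [hind, hind, hcoincide]
  rw [Measure.restrict_apply hs, volumeMeasure_eq_sum, Measure.finsetSum_apply]
  rw [Finset.sum_congr rfl fun p _ => (withDensity_apply _ hsq).trans (hterm p),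
    ← lintegral_finsetSum _ fun p _ => measurable_chartPartition p]
  have hone : ∀ x, ∑ p ∈ chartPartitionIndices m S, ENNReal.ofReal (chartPartition m S p x) = 1 :=
    fun x => by
      rw [← ENNReal.ofReal_sum_of_nonneg fun p _ => (chartPartition m S).nonneg p x,
        sum_chartPartition, ENNReal.ofReal_one]
  simp only [hone, lintegral_one, Measure.restrict_apply_univ]
  rw [hc, ← Measure.restrict_apply hs, chartVolume_restrict_source]

theorem integrable_volumeMeasure {f : S → EuclideanSpace ℝ (Fin (m + 1))}
    (hf : IsImmersedHypersurface f) {F : S → ℝ} (hF : Continuous F)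
    (hi : ∀ p, IntegrableOn (fun y =>
      √(gramMatrix (inducedMetric f) (chartAt (EuclideanSpace ℝ (Fin m)) p) y).det *
        (chartPartition m S p ((chartAt (EuclideanSpace ℝ (Fin m)) p).symm y) *
          F ((chartAt (EuclideanSpace ℝ (Fin m)) p).symm y)))
      (chartAt (EuclideanSpace ℝ (Fin m)) p).target) :
    Integrable F (volumeMeasure (inducedMetric f)) ∧
      ∫ x, F x ∂(volumeMeasure (inducedMetric f)) = ∑ p ∈ chartPartitionIndices m S,
        ∫ y in (chartAt (EuclideanSpace ℝ (Fin m)) p).target,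
          √(gramMatrix (inducedMetric f) (chartAt (EuclideanSpace ℝ (Fin m)) p) y).det *
            (chartPartition m S p ((chartAt (EuclideanSpace ℝ (Fin m)) p).symm y) *
              F ((chartAt (EuclideanSpace ℝ (Fin m)) p).symm y)) := by
  have hlt : ∀ (p : S) (μ : Measure S),
      ∀ᵐ x ∂μ, ENNReal.ofReal (chartPartition m S p x) < ⊤ := fun p μ =>
    Filter.Eventually.of_forall fun _ => ENNReal.ofReal_lt_top
  have hρ : ∀ p x, (ENNReal.ofReal (chartPartition m S p x)).toReal • F x =
      chartPartition m S p x * F x := fun p x => by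
    rw [ENNReal.toReal_ofReal ((chartPartition m S).nonneg p x), smul_eq_mul]
  have hc : ∀ p, Continuous fun x => chartPartition m S p x * F x := fun p =>
    (chartPartition m S p).contMDiff.continuous.mul hF
  have hint : ∀ p ∈ chartPartitionIndices m S, Integrable F
      ((chartVolume (inducedMetric f) (chartAt (EuclideanSpace ℝ (Fin m)) p)).withDensity
        fun x => ENNReal.ofReal (chartPartition m S p x)) := fun p _ => by
    rw [integrable_withDensity_iff_integrable_smul₀' (measurable_chartPartition p).aemeasurable
      (hlt p _)]
    simp only [hρ]
    exact (integrable_chartVolume_iff hf p (hc p).continuousOn).2 (hi p)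
  rw [volumeMeasure_eq_sum]
  refine ⟨integrable_finsetSum_measure.2 hint, ?_⟩
  rw [integral_finsetSum_measure hint]
  refine Finset.sum_congr rfl fun p _ => ?_
  rw [integral_withDensity_eq_integral_toReal_smul₀ (measurable_chartPartition p).aemeasurable
    (hlt p _)]
  simp only [hρ]
  exact integral_chartVolume hf p (hc p).continuousOn

theorem integrable_volumeMeasure_of_support_subset {f : S → EuclideanSpace ℝ (Fin (m + 1))}
    (hf : IsImmersedHypersurface f) (p : S) {F : S → ℝ}
    (hF : ContinuousOn F (chartAt (EuclideanSpace ℝ (Fin m)) p).source)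
    (hs : Function.support F ⊆ (chartAt (EuclideanSpace ℝ (Fin m)) p).source)
    (hi : IntegrableOn (fun y =>
      √(gramMatrix (inducedMetric f) (chartAt (EuclideanSpace ℝ (Fin m)) p) y).det *
        F ((chartAt (EuclideanSpace ℝ (Fin m)) p).symm y))
      (chartAt (EuclideanSpace ℝ (Fin m)) p).target) :
    Integrable F (volumeMeasure (inducedMetric f)) ∧
      ∫ x, F x ∂(volumeMeasure (inducedMetric f)) =
        ∫ y in (chartAt (EuclideanSpace ℝ (Fin m)) p).target,
          √(gramMatrix (inducedMetric f) (chartAt (EuclideanSpace ℝ (Fin m)) p) y).det *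
            F ((chartAt (EuclideanSpace ℝ (Fin m)) p).symm y) := by
  constructor
  · rw [← integrableOn_iff_integrable_of_support_subset hs, IntegrableOn,
      volumeMeasure_restrict_source hf]
    exact (integrable_chartVolume_iff hf p hF).2 hi
  · rw [← setIntegral_eq_integral_of_forall_compl_eq_zero fun x hx =>
      Function.notMem_support.1 fun h => hx (hs h), volumeMeasure_restrict_source hf]
    exact integral_chartVolume hf p hF

end Partition

end Volume

/-! ### Invariance of the total mean curvature -/

section Invariance

open MeasureTheory

variable {m : ℕ} {S : Type*} [TopologicalSpace S] [ChartedSpace (EuclideanSpace ℝ (Fin m)) S]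
  [IsManifold (𝓡 m) ∞ S]

omit [IsManifold (𝓡 m) ∞ S] in
theorem tangentDeriv_sum {ι : Type*} (T : Finset ι) {F : ι → S → ℝ} {x : S}
    (hF : ∀ p, MDifferentiableAt (𝓡 m) 𝓘(ℝ, ℝ) (F p) x) :
    MDifferentiableAt (𝓡 m) 𝓘(ℝ, ℝ) (fun z => ∑ p ∈ T, F p z) x ∧
      tangentDeriv (m := m) (fun z => ∑ p ∈ T, F p z) x = ∑ p ∈ T, tangentDeriv (F p) x := by
  classical
  induction T using Finset.induction_on with
  | empty =>
    simp only [Finset.sum_empty]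
    refine ⟨mdifferentiableAt_const, ?_⟩
    rw [tangentDeriv, mfderiv_const]
    rfl
  | insert q T hq ih =>
    simp only [Finset.sum_insert hq]
    refine ⟨(hF q).add ih.1, ?_⟩
    rw [← ih.2]
    exact congrArg ContinuousLinearMap.toLinearMap (mfderiv_add (hF q) ih.1)

theorem continuousOn_source_of_continuousOn_target {f : S → EuclideanSpace ℝ (Fin (m + 1))}
    (hf : IsImmersedHypersurface f) (p : S) {F : S → ℝ}
    (hF : ContinuousOn (fun y =>
      √(gramMatrix (inducedMetric f) (chartAt (EuclideanSpace ℝ (Fin m)) p) y).det *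
        F ((chartAt (EuclideanSpace ℝ (Fin m)) p).symm y))
      (chartAt (EuclideanSpace ℝ (Fin m)) p).target) :
    ContinuousOn F (chartAt (EuclideanSpace ℝ (Fin m)) p).source := by
  have hdet := continuousOn_det_gramMatrix (mdifferentiable_chartAt p) hf (chart_mem_atlas _ p)
  have hpos := fun y hy => det_gramMatrix_pos (mdifferentiable_chartAt p) hf (y := y) hy
  set e := chartAt (EuclideanSpace ℝ (Fin m)) p with hedef
  have h1 : ContinuousOn (fun y => F (e.symm y)) e.target :=
    (hF.div hdet.sqrt fun y hy => (Real.sqrt_pos.2 (hpos y hy)).ne').congr fun y hy =>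
      (mul_div_cancel_left₀ _ (Real.sqrt_pos.2 (hpos y hy)).ne').symm
  exact (h1.comp e.continuousOn e.mapsTo).congr fun x hx => by
    rw [Function.comp_apply, e.left_inv hx]

section Partition

variable [CompactSpace S] [T2Space S]

theorem isCompact_image_tsupport_chartPartition (p : S) :
    IsCompact (chartAt (EuclideanSpace ℝ (Fin m)) p '' tsupport (chartPartition m S p)) :=
  (isClosed_tsupport _).isCompact.image_of_continuousOn
    ((chartAt _ p).continuousOn.mono (chartPartition_isSubordinate m S p))

theorem image_tsupport_chartPartition_subset (p : S) :
    chartAt (EuclideanSpace ℝ (Fin m)) p '' tsupport (chartPartition m S p) ⊆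
      (chartAt (EuclideanSpace ℝ (Fin m)) p).target := by
  rintro _ ⟨x, hx, rfl⟩
  exact (chartAt _ p).map_source (chartPartition_isSubordinate m S p hx)

theorem contDiffOn_chartPartition_comp_symm (p : S) :
    ContDiffOn ℝ ∞
      (fun y => chartPartition m S p ((chartAt (EuclideanSpace ℝ (Fin m)) p).symm y))
      (chartAt (EuclideanSpace ℝ (Fin m)) p).target :=
  contMDiffOn_iff_contDiffOn.1
    ((chartPartition m S p).contMDiff.comp_contMDiffOn contMDiffOn_chart_symm)

theorem chartPartition_comp_symm_eq_zero (p : S) :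
    ∀ y ∈ (chartAt (EuclideanSpace ℝ (Fin m)) p).target,
      y ∉ chartAt (EuclideanSpace ℝ (Fin m)) p '' tsupport (chartPartition m S p) →
      chartPartition m S p ((chartAt (EuclideanSpace ℝ (Fin m)) p).symm y) = 0 := by
  intro y hy hyK
  by_contra h
  exact hyK ⟨_, subset_tsupport _ h, (chartAt _ p).right_inv hy⟩

theorem mdifferentiable_chartPartition (p : S) :
    MDifferentiable (𝓡 m) 𝓘(ℝ, ℝ) (chartPartition m S p) :=
  (chartPartition m S p).contMDiff.mdifferentiable (by simp)

theorem tangentDeriv_chartPartition_eq_zero {p x : S} (hx : x ∉ tsupport (chartPartition m S p)) :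
    tangentDeriv (m := m) (chartPartition m S p) x = 0 := by
  have h1 : (chartPartition m S p : S → ℝ) =ᶠ[nhds x] fun _ => 0 :=
    notMem_tsupport_iff_eventuallyEq.1 hx
  rw [tangentDeriv, h1.mfderiv_eq, mfderiv_const]
  rfl

/-- The differentials of a partition of unity sum to zero. -/
theorem sum_tangentDeriv_chartPartition (x : S) (X : TangentSpace (𝓡 m) x) :
    ∑ p ∈ chartPartitionIndices m S, tangentDeriv (chartPartition m S p) x X = 0 := by
  have h1 := (tangentDeriv_sum (chartPartitionIndices m S) (x := x)
    fun p => mdifferentiable_chartPartition (m := m) p x).2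
  have h2 : (fun z => ∑ p ∈ chartPartitionIndices m S, chartPartition m S p z) = fun _ => 1 :=
    funext sum_chartPartition
  rw [h2] at h1
  rw [← LinearMap.sum_apply, ← h1, tangentDeriv, mfderiv_const]
  rfl

end Partition

variable [CompactSpace S] [T2Space S] [MeasurableSpace S] [BorelSpace S]
  {f ν : ℝ → S → EuclideanSpace ℝ (Fin (m + 1))} (hf : IsIsometricDeformation f)
  (hν : IsUnitNormalFamily f ν)
include hf hν

omit [CompactSpace S] [T2Space S] [MeasurableSpace S] [BorelSpace S] in
theorem continuous_meanCurvature {t : ℝ} (ht : t ∈ Set.Icc (0 : ℝ) 1) :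
    Continuous (meanCurvature (f t) (ν t)) := by
  refine continuous_iff_continuousAt.2 fun p => ?_
  refine (continuousOn_source_of_continuousOn_target (hf.immersed 0 ⟨le_rfl, zero_le_one⟩) p
    ?_).continuousAt ((chartAt _ p).open_source.mem_nhds (mem_chart_source _ p))
  have h1 := ((isBendingInCoordinates hf hν p).contDiffOn_meanCurvatureDensity
    (by simp)).continuousOn.comp (f := fun y => (t, y)) (s := (chartAt _ p).target)
    (by fun_prop) fun y hy => ⟨ht, hy⟩
  exact h1.neg.congr fun y hy => by
    rw [Pi.neg_apply, Function.comp_apply, meanCurvatureDensity_inChart hf hν p ht hy, neg_neg]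

/-- The integral `-∫ ρₚ H dA` over the chart at `p`, where `ρₚ` is the member `p` of the
partition of unity. -/
def chartMeanCurvatureIntegral (f ν : ℝ → S → EuclideanSpace ℝ (Fin (m + 1))) (p : S) (t : ℝ) : ℝ :=
  ∫ y in (chartAt (EuclideanSpace ℝ (Fin m)) p).target,
    chartPartition m S p ((chartAt (EuclideanSpace ℝ (Fin m)) p).symm y) *
      meanCurvatureDensity (coordBasis m)
        (gramMatrix (inducedMetric (f 0)) (chartAt (EuclideanSpace ℝ (Fin m)) p))
        (inChart (chartAt (EuclideanSpace ℝ (Fin m)) p) f)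
        (inChart (chartAt (EuclideanSpace ℝ (Fin m)) p) ν) (t, y)

theorem integral_meanCurvature {t : ℝ} (ht : t ∈ Set.Icc (0 : ℝ) 1) :
    Integrable (meanCurvature (f t) (ν t)) (volumeMeasure (inducedMetric (f 0))) ∧
      ∫ x, meanCurvature (f t) (ν t) x ∂(volumeMeasure (inducedMetric (f 0))) =
        -∑ p ∈ chartPartitionIndices m S, chartMeanCurvatureIntegral f ν p t := by
  have heq : ∀ p, Set.EqOn (fun y =>
      √(gramMatrix (inducedMetric (f 0)) (chartAt (EuclideanSpace ℝ (Fin m)) p) y).det *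
        (chartPartition m S p ((chartAt (EuclideanSpace ℝ (Fin m)) p).symm y) *
          meanCurvature (f t) (ν t) ((chartAt (EuclideanSpace ℝ (Fin m)) p).symm y)))
      (fun y => -(chartPartition m S p ((chartAt (EuclideanSpace ℝ (Fin m)) p).symm y) *
        meanCurvatureDensity (coordBasis m)
          (gramMatrix (inducedMetric (f 0)) (chartAt (EuclideanSpace ℝ (Fin m)) p))
          (inChart (chartAt (EuclideanSpace ℝ (Fin m)) p) f)
          (inChart (chartAt (EuclideanSpace ℝ (Fin m)) p) ν) (t, y)))
      (chartAt (EuclideanSpace ℝ (Fin m)) p).target := fun p y hy => by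
    beta_reduce
    rw [meanCurvatureDensity_inChart hf hν p ht hy]
    ring
  have hmeas : ∀ p : S, MeasurableSet (chartAt (EuclideanSpace ℝ (Fin m)) p).target := fun p =>
    (chartAt _ p).open_target.measurableSet
  have h1 := integrable_volumeMeasure (hf.immersed 0 ⟨le_rfl, zero_le_one⟩)
    (continuous_meanCurvature hf hν ht) fun p => (integrableOn_congr_fun (heq p) (hmeas p)).2
      ((isBendingInCoordinates hf hν p).integrableOn_meanCurvatureDensity (by simp)
        (isCompact_image_tsupport_chartPartition p) (image_tsupport_chartPartition_subset p)
        (contDiffOn_chartPartition_comp_symm p) (chartPartition_comp_symm_eq_zero p) ht).neg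
  refine ⟨h1.1, h1.2.trans ?_⟩
  rw [← Finset.sum_neg_distrib]
  refine Finset.sum_congr rfl fun p _ => ?_
  rw [setIntegral_congr_fun (hmeas p) (heq p), integral_neg, chartMeanCurvatureIntegral]

omit [MeasurableSpace S] [BorelSpace S] in
theorem continuousOn_chartMeanCurvatureIntegral (p : S) :
    ContinuousOn (chartMeanCurvatureIntegral f ν p) (Set.Icc 0 1) :=
  (isBendingInCoordinates hf hν p).continuousOn_integral_meanCurvatureDensity (by simp)
    (isCompact_image_tsupport_chartPartition p) (image_tsupport_chartPartition_subset p)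
    (contDiffOn_chartPartition_comp_symm p) (chartPartition_comp_symm_eq_zero p)

/-- The variation of the contribution of a chart is an integral over the whole manifold of an
expression that does not depend on the chart. -/
theorem hasDerivAt_chartMeanCurvatureIntegral (p : S) {t : ℝ} (ht : t ∈ Set.Ioo (0 : ℝ) 1) :
    Integrable (derivAlongNormalVelocity f ν (chartPartition m S p) t)
      (volumeMeasure (inducedMetric (f 0))) ∧
    HasDerivAt (chartMeanCurvatureIntegral f ν p)
      (-∫ x, derivAlongNormalVelocity f ν (chartPartition m S p) t x
        ∂(volumeMeasure (inducedMetric (f 0)))) t := by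
  have hB := isBendingInCoordinates hf hν p
  have hf0 := hf.immersed 0 ⟨le_rfl, zero_le_one⟩
  have heq := fun y hy => sum_fderiv_mul_normalVelocityDensity_inChart hf hν p ht (y := y) hy
    (mdifferentiable_chartPartition p)
  have hmeas : MeasurableSet (chartAt (EuclideanSpace ℝ (Fin m)) p).target :=
    (chartAt _ p).open_target.measurableSet
  have hsupp : Function.support (derivAlongNormalVelocity f ν (chartPartition m S p) t) ⊆
      (chartAt (EuclideanSpace ℝ (Fin m)) p).source := fun x hx => by
    by_contra h
    refine hx ?_
    rw [derivAlongNormalVelocity, tangentDeriv_chartPartition_eq_zero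
      fun h' => h (chartPartition_isSubordinate m S p h')]
    rfl
  have hcont := continuousOn_source_of_continuousOn_target hf0 p
    ((hB.continuousOn_sum_normalVelocityDensity (by simp)
      (contDiffOn_chartPartition_comp_symm p) ht).congr fun y hy => (heq y hy).symm)
  have hint := (integrableOn_congr_fun heq hmeas).1
    (hB.integrableOn_sum_normalVelocityDensity (μ := volume) (by simp)
      (isCompact_image_tsupport_chartPartition p) (image_tsupport_chartPartition_subset p)
      (contDiffOn_chartPartition_comp_symm p) (chartPartition_comp_symm_eq_zero p) ht)
  have h1 := integrable_volumeMeasure_of_support_subset hf0 p hcont hsupp hint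
  refine ⟨h1.1, ?_⟩
  rw [h1.2, ← setIntegral_congr_fun hmeas heq]
  exact hB.hasDerivAt_integral_meanCurvatureDensity (by simp)
    (isCompact_image_tsupport_chartPartition p) (image_tsupport_chartPartition_subset p)
    (contDiffOn_chartPartition_comp_symm p) (chartPartition_comp_symm_eq_zero p) ht

theorem hasDerivAt_sum_chartMeanCurvatureIntegral {t : ℝ} (ht : t ∈ Set.Ioo (0 : ℝ) 1) :
    HasDerivAt (fun t => ∑ p ∈ chartPartitionIndices m S, chartMeanCurvatureIntegral f ν p t)
      0 t := by
  have h1 := HasDerivAt.fun_sum fun p (_ : p ∈ chartPartitionIndices m S) =>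
    (hasDerivAt_chartMeanCurvatureIntegral hf hν p ht).2
  rw [Finset.sum_neg_distrib, ← integral_finsetSum _ fun p _ =>
    (hasDerivAt_chartMeanCurvatureIntegral hf hν p ht).1] at h1
  simpa only [derivAlongNormalVelocity, sum_tangentDeriv_chartPartition, integral_zero,
    neg_zero] using h1

theorem sum_chartMeanCurvatureIntegral_eq {t : ℝ} (ht : t ∈ Set.Icc (0 : ℝ) 1) :
    ∑ p ∈ chartPartitionIndices m S, chartMeanCurvatureIntegral f ν p t =
      ∑ p ∈ chartPartitionIndices m S, chartMeanCurvatureIntegral f ν p 0 := by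
  rcases ht.1.eq_or_lt with rfl | ht0
  · rfl
  obtain ⟨c, -, hc⟩ := exists_hasDerivAt_eq_slope
    (fun t => ∑ p ∈ chartPartitionIndices m S, chartMeanCurvatureIntegral f ν p t) (fun _ => 0) ht0
    (continuousOn_finsetSum _ fun p _ => (continuousOn_chartMeanCurvatureIntegral hf hν p).mono
      (Set.Icc_subset_Icc_right ht.2))
    fun s hs => hasDerivAt_sum_chartMeanCurvatureIntegral hf hν ⟨hs.1, hs.2.trans_le ht.2⟩
  have h2 := (div_eq_zero_iff.1 hc.symm).resolve_right (by linarith)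
  linarith

end Invariance

end HypersurfaceBending

end

theorem mainTheorem5 (m : ℕ) {S : Type*} [TopologicalSpace S]
    [ChartedSpace (EuclideanSpace ℝ (Fin m)) S] [IsManifold (𝓡 m) ∞ S]
    [CompactSpace S] [T2Space S] [MeasurableSpace S] [BorelSpace S]
    (f ν : ℝ → S → EuclideanSpace ℝ (Fin (m + 1)))
    (hf : HypersurfaceBending.IsIsometricDeformation f)
    (hν : HypersurfaceBending.IsUnitNormalFamily f ν) :
    ∀ t ∈ Set.Icc (0 : ℝ) 1,
      MeasureTheory.Integrable (HypersurfaceBending.meanCurvature (f t) (ν t))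
          (HypersurfaceBending.volumeMeasure (HypersurfaceBending.inducedMetric (f t))) ∧
        ∫ x, HypersurfaceBending.meanCurvature (f t) (ν t) x
            ∂(HypersurfaceBending.volumeMeasure (HypersurfaceBending.inducedMetric (f t))) =
          ∫ x, HypersurfaceBending.meanCurvature (f 0) (ν 0) x
            ∂(HypersurfaceBending.volumeMeasure (HypersurfaceBending.inducedMetric (f 0))) := by
  intro t ht
  rw [hf.isometric t ht]
  have h1 := HypersurfaceBending.integral_meanCurvature hf hν ht
  have h0 := HypersurfaceBending.integral_meanCurvature hf hν (t := 0) ⟨le_rfl, zero_le_one⟩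
  refine ⟨h1.1, ?_⟩
  rw [h1.2, h0.2, HypersurfaceBending.sum_chartMeanCurvatureIntegral_eq hf hν ht]
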